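/- **Theorem (Third order approximations for the left Riemann–Liouville derivative).** For $\beta>0$ put $n=\lfloor\beta\rfloor+1$ and let $${}_{-\infty}D_x^{\beta}u(x)=\frac{1}{\Gamma(n-\beta)}\frac{d^n}{dx^n}\int_{-\infty}^x (x-\xi)^{n-\beta-1}u(\xi)\,d\xi$$ denote the left Riemann–Liouville derivative of order $\beta$; it is said to exist if the integral converges absolutely for every $x\in\mathbb R$ and is $n$ times differentiable on $\mathbb R$ as a function of $x$. Let $1<\alpha<2$, and let $p,q,r,s$ be integers with $p\ne q$, $r\ne s$ and $rs\neq pq$. Put $$g_k^{\alpha}=(-1)^k\binom{\alpha}{k},\qquad q_k^{\alpha}=\left(\tfrac32\right)^{\alpha}\sum_{m=0}^{k}3^{-m}g_m^{\alpha}g_{k-m}^{\alpha}\qquad(k\ge 0),$$ and, for $h>0$ and integers $a\neq b$, define $${}_LA_{a}^{\alpha}u(x)=\frac1{h^{\alpha}}\sum_{k=0}^{\infty}q_k^{\alpha}\,u(x-(k-a)h),\qquad {}_{2L}A_{a,b}^{\alpha}u(x)=\frac{b}{b-a}\,{}_LA_{a}^{\alpha}u(x)+\frac{a}{a-b}\,{}_LA_{b}^{\alpha}u(x),$$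 and $${}_{3L}A_{p,q,r,s}^{\alpha}u(x)=w_{p,q}\,{}_{2L}A_{p,q}^{\alpha}u(x)+w_{r,s}\,{}_{2L}A_{r,s}^{\alpha}u(x),\qquad w_{p,q}=\frac{3rs+2\alpha}{3(rs-pq)},\quad w_{r,s}=\frac{3pq+2\alpha}{3(pq-rs)}.$$ Let $u:\mathbb R\to\mathbb C$ be continuous, suppose that ${}_{-\infty}D_x^{\alpha+3}u$ exists, and suppose that $u$, ${}_{-\infty}D_x^{\alpha+3}u$ and the Fourier transforms of these two functions belong to $L_1(\mathbb R)$. Then ${}_{-\infty}D_x^{\alpha}u$ exists, the series defining ${}_LA_{m}^{\alpha}u(x)$ converges absolutely for all $m\in\mathbb Z$, $h>0$ and $x\in\mathbb R$, and $${}_{-\infty}D_x^{\alpha}u(x)={}_{3L}A_{p,q,r,s}^{\alpha}u(x)+\mathcal O(h^3)$$ uniformly in $x$; that is, there is a constant $C$, independent of $h$ and $x$, such that $$\left|{}_{-\infty}D_x^{\alpha}u(x)-{}_{3L}A_{p,q,r,s}^{\alpha}u(x)\right|\le C\,h^3\qquad\text{for all }h>0,\ x\in\mathbb R.$$ -/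

import Mathlib

open MeasureTheory Set

noncomputable section

namespace WSLD

/-- The number `n = ⌊β⌋ + 1` of classical derivatives in the Riemann–Liouville derivative
of order `β`, so that `n - 1 ≤ β < n` for `β ≥ 0`. -/
def rlOrder (β : ℝ) : ℕ := ⌊β⌋₊ + 1

/-- The integrand `ξ ↦ (x - ξ)^(γ - 1) u(ξ)` of the left fractional integral of order `γ`. -/
def leftRLIntegrand (γ : ℝ) (u : ℝ → ℂ) (x ξ : ℝ) : ℂ :=
  (((x - ξ) ^ (γ - 1) : ℝ) : ℂ) * u ξ

/-- The left Riemann–Liouville fractional integral of order `γ` on the half-line `(-∞, x)`: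
`(1 / Γ(γ)) ∫_{-∞}^x (x - ξ)^(γ - 1) u(ξ) dξ`. -/
def leftRLIntegral (γ : ℝ) (u : ℝ → ℂ) (x : ℝ) : ℂ :=
  ((1 / Real.Gamma γ : ℝ) : ℂ) * ∫ ξ in Iio x, leftRLIntegrand γ u x ξ

/-- The left Riemann–Liouville derivative of order `β` with lower limit `-∞`:
`(1 / Γ(n - β)) (d/dx)^n ∫_{-∞}^x (x - ξ)^(n - β - 1) u(ξ) dξ` with `n = ⌊β⌋ + 1`.
It is meaningful when `HasLeftRLDeriv β u` holds. -/
def leftRLDeriv (β : ℝ) (u : ℝ → ℂ) : ℝ → ℂ :=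
  iteratedDeriv (rlOrder β) (leftRLIntegral (rlOrder β - β) u)

/-- The left Riemann–Liouville derivative of order `β` of `u` exists at every point: the
fractional integral converges at every `x`, and it is `n` times differentiable on `ℝ`
(no continuity of the last derivative is required). -/
def HasLeftRLDeriv (β : ℝ) (u : ℝ → ℂ) : Prop :=
  (∀ x : ℝ, IntegrableOn (leftRLIntegrand (rlOrder β - β) u x) (Iio x)) ∧
  ∀ k < rlOrder β, Differentiable ℝ (iteratedDeriv k (leftRLIntegral (rlOrder β - β) u))

/-- The coefficients `g_k = (-1)^k binom(α, k)` of the power series of `(1 - ζ)^α`. -/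
def grunwaldCoeff (α : ℝ) (k : ℕ) : ℝ := (-1) ^ k * Ring.choose α k

/-- The coefficients `q_k = (3/2)^α ∑_{m=0}^k 3^(-m) g_m g_{k-m}` of the power series of
`(3/2 - 2ζ + ζ²/2)^α`. -/
def lubichCoeff (α : ℝ) (k : ℕ) : ℝ :=
  (3 / 2 : ℝ) ^ α * ∑ m ∈ Finset.range (k + 1),
    ((3 : ℝ) ^ m)⁻¹ * grunwaldCoeff α m * grunwaldCoeff α (k - m)

/-- The `k`-th term `q_k u(x - (k - p) h)` of the shifted Lubich series. -/
def lubichTerm (α : ℝ) (p : ℤ) (h : ℝ) (u : ℝ → ℂ) (x : ℝ) (k : ℕ) : ℂ :=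
  (lubichCoeff α k : ℂ) * u (x - ((k : ℝ) - (p : ℝ)) * h)

/-- The shifted Lubich operator
`_L A_p u(x) = h^(-α) ∑_{k=0}^∞ q_k u(x - (k - p) h)`. -/
def lubichOp (α : ℝ) (p : ℤ) (h : ℝ) (u : ℝ → ℂ) (x : ℝ) : ℂ :=
  ((1 / h ^ α : ℝ) : ℂ) * ∑' k : ℕ, lubichTerm α p h u x k

/-- The operator `_{2L}A_{p,q} = w_p _L A_p + w_q _L A_q`, with `w_p = q / (q - p)` and
`w_q = p / (p - q)`; it is meant for `p ≠ q`. -/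
def lubichOp₂ (α : ℝ) (p q : ℤ) (h : ℝ) (u : ℝ → ℂ) (x : ℝ) : ℂ :=
  (((q : ℝ) / ((q : ℝ) - p) : ℝ) : ℂ) * lubichOp α p h u x +
    (((p : ℝ) / ((p : ℝ) - q) : ℝ) : ℂ) * lubichOp α q h u x

/-- The weight `(3rs + 2α) / (3(rs - pq))`. Exchanging `(p, q)` and `(r, s)` gives the weight
`w_{r,s}`. -/
def weight₃ (α : ℝ) (p q r s : ℤ) : ℝ :=
  (3 * ((r : ℝ) * s) + 2 * α) / (3 * ((r : ℝ) * s - (p : ℝ) * q))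

/-- The operator `_{3L}A_{p,q,r,s} = w_{p,q} _{2L}A_{p,q} + w_{r,s} _{2L}A_{r,s}`; it is meant
for `p ≠ q`, `r ≠ s` and `rs ≠ pq`. -/
def lubichOp₃ (α : ℝ) (p q r s : ℤ) (h : ℝ) (u : ℝ → ℂ) (x : ℝ) : ℂ :=
  (weight₃ α p q r s : ℂ) * lubichOp₂ α p q h u x +
    (weight₃ α r s p q : ℂ) * lubichOp₂ α r s h u x

end WSLD

end

noncomputable section

namespace WSLD

open Filter Topology Asymptotics
open scoped FourierTransform

/-! ### Coefficients and generating functions -/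

/-! Everything is compared on the Fourier side. Write `f = 𝓕 u` and ζ = 2πiω. The derivative of
order α multiplies `f` by ζ^α, and the shifted Lubich operator multiplies it by h^{-α} e^{mhζ}
W(e^{-hζ}), where W(z) = (3/2)^α (1 - z/3)^α (1 - z)^α (`integrable_and_lubichOp_fourierInv`).

On the imaginary axis near 0, W(e^{-ζ}) = ζ^α Q(ζ)^α with Q = `bdfQuotient` = 1 - ζ²/3 + O(ζ³), so
e^{aζ} Q^α = 1 + aζ + (a²/2 - α/3)ζ² + O(ζ³). The weights of the four shifts cancel the terms in ζ
and ζ². Away from 0 the factor W is bounded, so the error of the symbol is at most C|ζ|^{α+3} on the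
whole axis (`exists_norm_sum_lubichSymbol_sub_le`). Replacing ζ by hζ turns this into C h³
|ζ|^{α+3}, which is integrated against |f|.

It remains to see that ζ^{α+3} f is integrable, being the transform of the derivative of order α+3.
The fractional integral of order 2-α is `𝓕⁻ b` with b = ζ^{-(2-α)} f (`leftRLIntegral_fourierInv`,
by exponential damping). Its fifth derivative is some `𝓕⁻ a` with `a` integrable, but no moments of
`b` are known in advance. Finite differences have bounded multipliers and give a = ζ⁵ b almost
everywhere (`ae_eq_freq_pow_mul`). -/

lemma grunwaldCoeff_zero (α : ℝ) : grunwaldCoeff α 0 = 1 := by simp [grunwaldCoeff]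

lemma grunwaldCoeff_succ (α : ℝ) (k : ℕ) :
    ((k : ℝ) + 1) * grunwaldCoeff α (k + 1) = ((k : ℝ) - α) * grunwaldCoeff α k := by
  have hf : ((k.factorial : ℝ)) ≠ 0 := by positivity
  simp only [grunwaldCoeff, Ring.choose_eq_smul, descPochhammer_succ_right,
    Polynomial.smeval_mul, Polynomial.smeval_sub, Polynomial.smeval_X, Polynomial.smeval_natCast,
    Nat.factorial_succ, smul_eq_mul]
  push_cast
  field_simp
  simp
  ring

/-- In the recursion (k+1) g_{k+1} = (k-α) g_k the factor k - α is positive from k = 2 on, and g_2 =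
α(α-1)/2 is positive. -/
lemma grunwaldCoeff_nonneg {α : ℝ} (hα₁ : 1 < α) (hα₂ : α < 2) (k : ℕ) :
    0 ≤ grunwaldCoeff α (k + 2) := by
  induction k with
  | zero =>
    have h0 := grunwaldCoeff_succ α 0
    have h1 := grunwaldCoeff_succ α 1
    rw [grunwaldCoeff_zero] at h0
    norm_num at h0 h1
    rw [h0] at h1
    norm_num
    nlinarith
  | succ k ih =>
    have h := grunwaldCoeff_succ α (k + 2)
    push_cast at h
    have h1 : 0 ≤ ((k : ℝ) + 2 - α) * grunwaldCoeff α (k + 2) :=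
      mul_nonneg (by have : (0 : ℝ) ≤ k := k.cast_nonneg
                     linarith) ih
    rw [← h] at h1
    exact nonneg_of_mul_nonneg_right h1 (by positivity)

/-- The recursion telescopes: α g_k = k g_k - (k+1) g_{k+1}. Nonnegativity from index 2 on then
bounds the partial sums by 2 g_2 / α. -/
lemma summable_norm_grunwaldCoeff {α : ℝ} (hα₁ : 1 < α) (hα₂ : α < 2) :
    Summable fun k ↦ ‖grunwaldCoeff α k‖ := by
  rw [← summable_nat_add_iff 2]
  have hnn := grunwaldCoeff_nonneg hα₁ hα₂
  simp only [Real.norm_of_nonneg (hnn _)]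
  refine summable_of_sum_range_le (c := 2 * grunwaldCoeff α 2 / α) hnn fun n ↦ ?_
  rw [le_div_iff₀ (by linarith), Finset.sum_mul]
  have h : ∀ n : ℕ, ∑ i ∈ Finset.range n, grunwaldCoeff α (i + 2) * α =
      2 * grunwaldCoeff α 2 - ((n : ℝ) + 2) * grunwaldCoeff α (n + 2) := by
    intro n
    induction n with
    | zero => simp
    | succ n ih =>
      rw [Finset.sum_range_succ, ih]
      have h := grunwaldCoeff_succ α (n + 2)
      push_cast at h ⊢
      linear_combination h
  rw [h]
  have := mul_nonneg (by positivity : (0 : ℝ) ≤ (n : ℝ) + 2) (hnn n)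
  linarith

lemma hasSum_grunwaldCoeff_of_norm_lt_one (α : ℝ) {z : ℂ} (hz : ‖z‖ < 1) :
    HasSum (fun k ↦ (grunwaldCoeff α k : ℂ) * z ^ k) ((1 - z) ^ (α : ℂ)) := by
  have h := (Complex.one_add_cpow_hasFPowerSeriesOnBall_zero (a := (α : ℂ))).hasSum (y := -z)
    (by simpa [Metric.eball, edist_eq_enorm_sub, enorm_eq_nnnorm, ← NNReal.coe_lt_coe] using hz)
  rw [zero_add, ← sub_eq_add_neg] at h
  convert! h using 2 with k
  simp only [binomialSeries_apply, grunwaldCoeff, List.ofFn_const, List.prod_replicate, smul_eq_mul]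
  push_cast
  rw [neg_pow z]
  ring

/-- On the closed disk 1 - z has positive real part except at z = 1, so only the branch point itself
matters, and there α > 0 gives continuity. -/
lemma continuousAt_one_sub_cpow {α : ℝ} (hα : 0 < α) {z : ℂ} (hz : ‖z‖ ≤ 1) :
    ContinuousAt (fun w : ℂ ↦ (1 - w) ^ (α : ℂ)) z := by
  by_cases h : z = 1
  · subst h
    have h0 : ContinuousAt (fun w : ℂ ↦ w ^ (α : ℂ)) (1 - 1) := by
      have h1 := Complex.continuousAt_cpow_zero_of_re_pos (z := (α : ℂ)) (by simpa)
      have h2 : ContinuousAt (fun w : ℂ ↦ (w, (α : ℂ))) 0 := by fun_prop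
      rw [sub_self]
      exact ContinuousAt.comp (f := fun w : ℂ ↦ (w, (α : ℂ))) h1 h2
    exact ContinuousAt.comp (f := fun w : ℂ ↦ 1 - w) h0 (by fun_prop)
  · refine ContinuousAt.cpow (by fun_prop) (by fun_prop) (Or.inl ?_)
    have hre : z.re ≤ ‖z‖ := Complex.re_le_norm z
    rcases (hre.trans hz).lt_or_eq with h1 | h1
    · simpa using h1
    · exfalso
      apply h
      have h3 : z.re ^ 2 + z.im ^ 2 ≤ 1 := by
        have := Complex.sq_norm z
        rw [Complex.normSq_apply] at this
        nlinarith [norm_nonneg z]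
      have h4 : z.im = 0 := by
        rw [h1] at h3
        nlinarith
      exact Complex.ext h1 h4

/-- The binomial series for `(1 - z)^α` on the closed unit disk. -/
lemma tsum_grunwaldCoeff {α : ℝ} (hα₁ : 1 < α) (hα₂ : α < 2) {z : ℂ} (hz : ‖z‖ ≤ 1) :
    ∑' k, (grunwaldCoeff α k : ℂ) * z ^ k = (1 - z) ^ (α : ℂ) := by
  -- Abel's method: evaluate at rz with r < 1 and let r → 1. The series passes to the limit by
  -- domination with Σ|g_k|, the power by continuity.
  have hr : Tendsto (fun r : ℝ ↦ (r : ℂ) * z) (𝓝[<] 1) (𝓝 z) := by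
    have : ContinuousAt (fun r : ℝ ↦ (r : ℂ) * z) 1 := by fun_prop
    have h := this.tendsto
    simp only [Complex.ofReal_one, one_mul] at h
    exact h.mono_left nhdsWithin_le_nhds
  have hev : ∀ᶠ r : ℝ in 𝓝[<] 1, r ∈ Ioo (0 : ℝ) 1 := Ioo_mem_nhdsLT one_pos
  have hnorm : ∀ r ∈ Ioo (0 : ℝ) 1, ‖(r : ℂ) * z‖ < 1 := by
    intro r hr
    rw [norm_mul, Complex.norm_of_nonneg hr.1.le]
    nlinarith [hr.1, hr.2, norm_nonneg z]
  have h1 : Tendsto (fun r : ℝ ↦ ∑' k, (grunwaldCoeff α k : ℂ) * ((r : ℂ) * z) ^ k) (𝓝[<] 1)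
      (𝓝 (∑' k, (grunwaldCoeff α k : ℂ) * z ^ k)) := by
    refine tendsto_tsum_of_dominated_convergence (summable_norm_grunwaldCoeff hα₁ hα₂)
      (fun k ↦ (hr.pow k).const_mul _) ?_
    filter_upwards [hev] with r hr k
    rw [norm_mul, norm_pow, Complex.norm_real]
    exact mul_le_of_le_one_right (norm_nonneg _) (pow_le_one₀ (norm_nonneg _) (hnorm r hr).le)
  have h2 : Tendsto (fun r : ℝ ↦ ∑' k, (grunwaldCoeff α k : ℂ) * ((r : ℂ) * z) ^ k) (𝓝[<] 1)
      (𝓝 ((1 - z) ^ (α : ℂ))) := by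
    refine ((continuousAt_one_sub_cpow (by linarith) hz).tendsto.comp hr).congr' ?_
    filter_upwards [hev] with r hr
    exact (hasSum_grunwaldCoeff_of_norm_lt_one α (hnorm r hr)).tsum_eq.symm
  exact tendsto_nhds_unique h1 h2

/-- The symbol `(3/2)^α (1 - z)^α (1 - z/3)^α` of the Lubich series. -/
def lubichSymbol (α : ℝ) (z : ℂ) : ℂ :=
  (((3 / 2 : ℝ) ^ α : ℝ) : ℂ) * ((1 - z / 3) ^ (α : ℂ) * (1 - z) ^ (α : ℂ))

lemma lubichCoeff_mul_pow (α : ℝ) (z : ℂ) (k : ℕ) :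
    (lubichCoeff α k : ℂ) * z ^ k = (((3 / 2 : ℝ) ^ α : ℝ) : ℂ) *
      ∑ m ∈ Finset.range (k + 1), ((grunwaldCoeff α m : ℂ) * (z / 3) ^ m) *
        ((grunwaldCoeff α (k - m) : ℂ) * z ^ (k - m)) := by
  simp only [lubichCoeff]
  push_cast
  rw [mul_assoc, Finset.sum_mul]
  congr 1
  refine Finset.sum_congr rfl fun m hm ↦ ?_
  have hk : z ^ k = z ^ m * z ^ (k - m) := by
    rw [← pow_add, Nat.add_sub_cancel' (Nat.lt_succ_iff.mp (Finset.mem_range.mp hm))]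
  rw [hk, div_pow, div_eq_mul_inv]
  ring

lemma summable_norm_grunwaldCoeff_mul_pow {α : ℝ} (hα₁ : 1 < α) (hα₂ : α < 2) {z : ℂ}
    (hz : ‖z‖ ≤ 1) : Summable fun k ↦ ‖(grunwaldCoeff α k : ℂ) * z ^ k‖ := by
  refine (summable_norm_grunwaldCoeff hα₁ hα₂).of_nonneg_of_le (fun _ ↦ norm_nonneg _) fun k ↦ ?_
  rw [norm_mul, norm_pow, Complex.norm_real]
  exact mul_le_of_le_one_right (norm_nonneg _) (pow_le_one₀ (norm_nonneg _) hz)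

lemma norm_div_three_le {z : ℂ} (hz : ‖z‖ ≤ 1) : ‖z / 3‖ ≤ 1 := by
  rw [norm_div]
  norm_num
  linarith

lemma summable_norm_lubichCoeff {α : ℝ} (hα₁ : 1 < α) (hα₂ : α < 2) :
    Summable fun k ↦ ‖lubichCoeff α k‖ := by
  have h1 : ‖(1 : ℂ)‖ ≤ 1 := by simp
  have h := (summable_norm_sum_mul_range_of_summable_norm
    (summable_norm_grunwaldCoeff_mul_pow hα₁ hα₂ (norm_div_three_le h1))
    (summable_norm_grunwaldCoeff_mul_pow hα₁ hα₂ h1)).mul_left ‖(((3 / 2 : ℝ) ^ α : ℝ) : ℂ)‖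
  refine h.congr fun k ↦ ?_
  rw [← norm_mul, ← lubichCoeff_mul_pow, one_pow, mul_one, Complex.norm_real]

lemma tsum_lubichCoeff {α : ℝ} (hα₁ : 1 < α) (hα₂ : α < 2) {z : ℂ} (hz : ‖z‖ ≤ 1) :
    ∑' k, (lubichCoeff α k : ℂ) * z ^ k = lubichSymbol α z := by
  simp only [lubichCoeff_mul_pow]
  rw [tsum_mul_left, ← tsum_mul_tsum_eq_tsum_sum_range_of_summable_norm
    (summable_norm_grunwaldCoeff_mul_pow hα₁ hα₂ (norm_div_three_le hz))
    (summable_norm_grunwaldCoeff_mul_pow hα₁ hα₂ hz), tsum_grunwaldCoeff hα₁ hα₂ hz,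
    tsum_grunwaldCoeff hα₁ hα₂ (norm_div_three_le hz), lubichSymbol]

lemma norm_lubichSymbol_le {α : ℝ} (hα₁ : 1 < α) (hα₂ : α < 2) {z : ℂ} (hz : ‖z‖ ≤ 1) :
    ‖lubichSymbol α z‖ ≤ ∑' k, ‖lubichCoeff α k‖ := by
  rw [← tsum_lubichCoeff hα₁ hα₂ hz]
  refine tsum_of_norm_bounded (summable_norm_lubichCoeff hα₁ hα₂).hasSum fun k ↦ ?_
  rw [norm_mul, norm_pow, Complex.norm_real]
  exact mul_le_of_le_one_right (norm_nonneg _) (pow_le_one₀ (norm_nonneg _) hz)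

/-! ### Asymptotics of the symbol -/

/-- The arguments are below π/2 and at most π/2 in absolute value, so principal logarithms add.
Allowing equality for one factor makes this usable on the imaginary axis. -/
lemma mul_cpow_of_re {x y : ℂ} (hx : 0 < x.re) (hy : 0 ≤ y.re) (hy0 : y ≠ 0) (s : ℂ) :
    (x * y) ^ s = x ^ s * y ^ s := by
  have hx0 : x ≠ 0 := by rintro rfl; simp at hx
  have h1 := abs_lt.mp (Complex.abs_arg_lt_pi_div_two_iff.mpr (Or.inl hx))
  have h2 := abs_le.mp (Complex.abs_arg_le_pi_div_two_iff.mpr hy)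
  rw [Complex.cpow_def_of_ne_zero (mul_ne_zero hx0 hy0), Complex.cpow_def_of_ne_zero hx0,
    Complex.cpow_def_of_ne_zero hy0,
    Complex.log_mul hx0 hy0 ⟨by linarith [h1.1, h2.1], by linarith [h1.2, h2.2]⟩, add_mul,
    Complex.exp_add]

/-- The quotient `(3/2 - 2 e^{-ζ} + e^{-2ζ}/2) / ζ`. -/
def bdfQuotient (ζ : ℂ) : ℂ :=
  (3 / 2 - 2 * Complex.exp (-ζ) + Complex.exp (-(2 * ζ)) / 2) / ζ

lemma isBigO_pow_pow_of_le {m n : ℕ} (h : m ≤ n) :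
    (fun ζ : ℂ ↦ ζ ^ n) =O[𝓝[≠] 0] fun ζ ↦ ζ ^ m := by
  obtain ⟨k, rfl⟩ := Nat.exists_eq_add_of_le h
  have h1 : (fun ζ : ℂ ↦ ζ ^ k) =O[𝓝[≠] 0] fun _ ↦ (1 : ℂ) :=
    (((continuous_pow k).tendsto (0 : ℂ)).mono_left nhdsWithin_le_nhds).isBigO_one ℂ
  simpa [pow_add] using (isBigO_refl (fun ζ : ℂ ↦ ζ ^ m) (𝓝[≠] 0)).mul h1

/-- The numerator is ζ - ζ³/3 + O(ζ⁴). One order more than stated is expanded because of the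
division by ζ. -/
lemma bdfQuotient_isBigO :
    (fun ζ ↦ bdfQuotient ζ - 1 - (-(ζ ^ 2) / 3)) =O[𝓝[≠] 0] fun ζ ↦ ζ ^ 3 := by
  have h (c : ℂ) : (fun ζ : ℂ ↦ Complex.exp (c * ζ) - ∑ i ∈ Finset.range 4,
      (c * ζ) ^ i / (i.factorial : ℂ)) =O[𝓝[≠] 0] fun ζ ↦ ζ ^ 4 := by
    have ht : Tendsto (fun ζ : ℂ ↦ c * ζ) (𝓝[≠] 0) (𝓝 0) := by
      have : Continuous fun ζ : ℂ ↦ c * ζ := by fun_prop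
      simpa using (this.tendsto 0).mono_left nhdsWithin_le_nhds
    refine ((Complex.exp_sub_sum_range_isBigO_pow 4).comp_tendsto ht).trans ?_
    simp only [Function.comp_def, mul_pow]
    exact (isBigO_refl _ _).const_mul_left _
  have h4 : (fun ζ : ℂ ↦ 3 / 2 - 2 * Complex.exp (-ζ) + Complex.exp (-(2 * ζ)) / 2
      - (ζ - ζ ^ 3 / 3)) =O[𝓝[≠] 0] fun ζ ↦ ζ ^ 4 := by
    refine (((h (-1)).const_mul_left (-2)).add ((h (-2)).const_mul_left (1 / 2))).congr_left
      fun ζ ↦ ?_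
    simp only [Finset.sum_range_succ, Finset.sum_range_zero, Nat.factorial]
    push_cast
    rw [neg_one_mul, neg_mul]
    ring_nf
  have h5 := h4.mul (isBigO_refl (fun ζ : ℂ ↦ ζ⁻¹) (𝓝[≠] 0))
  refine (h5.congr' ?_ ?_)
  · filter_upwards [self_mem_nhdsWithin] with ζ (hζ : ζ ≠ 0)
    rw [bdfQuotient]
    field_simp
    ring
  · filter_upwards [self_mem_nhdsWithin] with ζ (hζ : ζ ≠ 0)
    field_simp

lemma bdfQuotient_sub_one_isBigO :
    (fun ζ ↦ bdfQuotient ζ - 1) =O[𝓝[≠] 0] fun ζ ↦ ζ ^ 2 := by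
  have h := (bdfQuotient_isBigO.trans (isBigO_pow_pow_of_le (by norm_num : 2 ≤ 3))).add
    ((isBigO_refl (fun ζ : ℂ ↦ ζ ^ 2) (𝓝[≠] 0)).const_mul_left (-1 / 3))
  exact h.congr_left fun ζ ↦ by ring

lemma tendsto_pow_zero {n : ℕ} (hn : n ≠ 0) :
    Tendsto (fun ζ : ℂ ↦ ζ ^ n) (𝓝[≠] 0) (𝓝 0) := by
  have h := ((continuous_pow n).tendsto (0 : ℂ)).mono_left (nhdsWithin_le_nhds (s := {0}ᶜ))
  simpa [hn] using h

lemma tendsto_bdfQuotient_sub_one : Tendsto (fun ζ ↦ bdfQuotient ζ - 1) (𝓝[≠] 0) (𝓝 0) :=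
  bdfQuotient_sub_one_isBigO.trans_tendsto (tendsto_pow_zero two_ne_zero)

lemma log_bdfQuotient_isBigO :
    (fun ζ ↦ Complex.log (bdfQuotient ζ) - (-(ζ ^ 2) / 3)) =O[𝓝[≠] 0] fun ζ ↦ ζ ^ 3 := by
  have h1 := Complex.log_sub_self_isBigO.comp_tendsto tendsto_bdfQuotient_sub_one
  have h2 : (fun ζ ↦ (bdfQuotient ζ - 1) ^ 2) =O[𝓝[≠] 0] fun ζ : ℂ ↦ ζ ^ 3 := by
    refine (bdfQuotient_sub_one_isBigO.pow 2).trans ?_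
    simp only [← pow_mul]
    exact isBigO_pow_pow_of_le (by norm_num)
  refine ((h1.trans h2).add bdfQuotient_isBigO).congr_left fun ζ ↦ ?_
  simp only [Function.comp_apply, add_sub_cancel]
  ring

/-- The product is exp X with X = aζ + α log Q = aζ - (α/3)ζ² + O(ζ³); expand exp to second order.
-/
lemma exp_mul_bdfQuotient_cpow_isBigO (α a : ℂ) :
    (fun ζ ↦ Complex.exp (a * ζ) * bdfQuotient ζ ^ α -
      (1 + a * ζ + (a ^ 2 / 2 - α / 3) * ζ ^ 2)) =O[𝓝[≠] 0] fun ζ ↦ ζ ^ 3 := by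
  set X : ℂ → ℂ := fun ζ ↦ a * ζ + Complex.log (bdfQuotient ζ) * α with hX
  have hX2 : (fun ζ ↦ X ζ - (a * ζ - α / 3 * ζ ^ 2)) =O[𝓝[≠] 0] fun ζ : ℂ ↦ ζ ^ 3 :=
    (log_bdfQuotient_isBigO.const_mul_left α).congr_left fun ζ ↦ by simp only [hX]; ring
  have hXa : (fun ζ ↦ X ζ - a * ζ) =O[𝓝[≠] 0] fun ζ : ℂ ↦ ζ ^ 2 := by
    refine ((hX2.trans (isBigO_pow_pow_of_le (by norm_num : 2 ≤ 3))).add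
      ((isBigO_refl (fun ζ : ℂ ↦ ζ ^ 2) (𝓝[≠] 0)).const_mul_left (-(α / 3)))).congr_left
        fun ζ ↦ by ring
  have hid : (fun ζ : ℂ ↦ ζ) =O[𝓝[≠] 0] fun ζ : ℂ ↦ ζ ^ 1 := by simpa using isBigO_refl _ _
  have hX1 : X =O[𝓝[≠] 0] fun ζ : ℂ ↦ ζ ^ 1 := by
    refine ((hXa.trans (isBigO_pow_pow_of_le (by norm_num : 1 ≤ 2))).add
      (hid.const_mul_left a)).congr_left fun ζ ↦ by ring
  -- Difference of squares: (X - aζ)(X + aζ) is O(ζ²)·O(ζ).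
  have hsq : (fun ζ ↦ X ζ ^ 2 - (a * ζ) ^ 2) =O[𝓝[≠] 0] fun ζ : ℂ ↦ ζ ^ 3 := by
    refine (hXa.mul (hX1.add (hid.const_mul_left a))).congr (fun ζ ↦ by ring) fun ζ ↦ by ring
  have hexp := ((Complex.exp_sub_sum_range_isBigO_pow 3).comp_tendsto
    (hX1.trans_tendsto (tendsto_pow_zero one_ne_zero))).trans
      (by simpa using hX1.pow 3 : (fun ζ ↦ X ζ ^ 3) =O[𝓝[≠] 0] fun ζ : ℂ ↦ ζ ^ 3)
  have hne : ∀ᶠ ζ in 𝓝[≠] 0, bdfQuotient ζ ≠ 0 := by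
    have h2 : ∀ᶠ ζ in 𝓝[≠] 0, bdfQuotient ζ - 1 ≠ -1 :=
      tendsto_bdfQuotient_sub_one.eventually_ne (by norm_num)
    filter_upwards [h2] with ζ h h0
    exact h (by rw [h0]; ring)
  refine ((hexp.add hX2).add (hsq.const_mul_left (1 / 2))).congr' ?_ EventuallyEq.rfl
  filter_upwards [hne] with ζ hζ
  rw [Complex.cpow_def_of_ne_zero hζ, ← Complex.exp_add]
  simp only [Function.comp_apply, Finset.sum_range_succ, Finset.sum_range_zero, Nat.factorial]
  push_cast
  simp only [hX]
  ring

/-- With z = e^{-ζ} one has (3/2)(1 - z/3)(1 - z) = Qζ. On both sides every factor has nonnegative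
real part and at most one lies on the boundary of the half-plane, so the powers split without
crossing the branch cut. -/
lemma lubichSymbol_exp_neg {α : ℝ} {ζ : ℂ} (hre : ζ.re = 0) (hζ : ζ ≠ 0)
    (hM : ‖bdfQuotient ζ - 1‖ < 1) :
    lubichSymbol α (Complex.exp (-ζ)) = ζ ^ (α : ℂ) * bdfQuotient ζ ^ (α : ℂ) := by
  set z := Complex.exp (-ζ) with hz
  have hz1 : ‖z‖ = 1 := by rw [hz, Complex.norm_exp]; simp [hre]
  have hzre : z.re ≤ 1 := hz1 ▸ Complex.re_le_norm z
  have hMre : 0 < (bdfQuotient ζ).re := by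
    have := (abs_le.mp (Complex.abs_re_le_norm (bdfQuotient ζ - 1))).1
    simp only [Complex.sub_re, Complex.one_re] at this
    linarith
  have hM0 : bdfQuotient ζ ≠ 0 := by
    intro h
    simp [h] at hMre
  have hprod : ((3 / 2 : ℝ) : ℂ) * (1 - z / 3) * (1 - z) = bdfQuotient ζ * ζ := by
    have h2 : Complex.exp (-(2 * ζ)) = z ^ 2 := by
      rw [hz, ← Complex.exp_nat_mul]
      congr 1
      push_cast
      ring
    rw [bdfQuotient, div_mul_cancel₀ _ hζ, ← hz, h2]
    push_cast
    ring
  have hy0 : 1 - z ≠ 0 := by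
    intro h
    rw [h, mul_zero] at hprod
    exact mul_ne_zero hM0 hζ hprod.symm
  have hre3 : 0 < (1 - z / 3).re := by
    have : (z / 3).re = z.re / 3 := by simp
    rw [Complex.sub_re, this, Complex.one_re]
    linarith
  have hx0 : 1 - z / 3 ≠ 0 := by
    intro h
    simp [h] at hre3
  rw [lubichSymbol, Complex.ofReal_cpow (by norm_num), ← mul_assoc,
    ← mul_cpow_of_re (by simp) hre3.le hx0, ← mul_cpow_of_re _ _ hy0, hprod,
    mul_cpow_of_re hMre hre.ge hζ, mul_comm]
  · rw [Complex.re_ofReal_mul]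
    positivity
  · simpa using hzre

/-- A combination of shifted symbols that matches `ζ^α` to third order does so on the whole
imaginary axis. -/
theorem exists_norm_sum_lubichSymbol_sub_le {α : ℝ} (hα₁ : 1 < α) (hα₂ : α < 2) {ι : Type*}
    (J : Finset ι) (c a : ι → ℝ) (h0 : ∑ j ∈ J, c j = 1) (h1 : ∑ j ∈ J, c j * a j = 0)
    (h2 : ∑ j ∈ J, c j * (a j ^ 2 / 2 - α / 3) = 0) :
    ∃ C : ℝ, ∀ ζ : ℂ, ζ.re = 0 →
      ‖ζ ^ (α : ℂ) - ∑ j ∈ J, (c j : ℂ) * (Complex.exp (a j * ζ) *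
        lubichSymbol α (Complex.exp (-ζ)))‖ ≤ C * ‖ζ‖ ^ (α + 3) := by
  have hO : (fun ζ ↦ ∑ j ∈ J, (c j : ℂ) * (Complex.exp (a j * ζ) * bdfQuotient ζ ^ (α : ℂ)) - 1)
      =O[𝓝[≠] 0] fun ζ : ℂ ↦ ζ ^ 3 := by
    have := IsBigO.sum (s := J) fun j _ ↦
      (exp_mul_bdfQuotient_cpow_isBigO (α : ℂ) (a j)).const_mul_left (c j : ℂ)
    refine this.congr_left fun ζ ↦ ?_
    have e0 : ∑ j ∈ J, (c j : ℂ) = 1 := by exact_mod_cast congrArg ((↑) : ℝ → ℂ) h0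
    have e1 : ∑ j ∈ J, (c j : ℂ) * a j = 0 := by exact_mod_cast congrArg ((↑) : ℝ → ℂ) h1
    have e2 : ∑ j ∈ J, (c j : ℂ) * ((a j : ℂ) ^ 2 / 2 - α / 3) = 0 := by
      exact_mod_cast congrArg ((↑) : ℝ → ℂ) h2
    have e3 : ∑ j ∈ J, (c j : ℂ) * (1 + a j * ζ + ((a j : ℂ) ^ 2 / 2 - α / 3) * ζ ^ 2) = 1 := by
      simp only [mul_add, Finset.sum_add_distrib, mul_one, ← mul_assoc, ← Finset.sum_mul]
      rw [e0, e1, e2]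
      ring
    rw [Finset.sum_apply]
    simp only [mul_sub (c _ : ℂ), Finset.sum_sub_distrib]
    rw [e3]
  obtain ⟨C, hC0, hC⟩ := hO.exists_pos
  have hM : ∀ᶠ ζ in 𝓝[≠] (0 : ℂ), ‖bdfQuotient ζ - 1‖ < 1 := by
    simpa using tendsto_bdfQuotient_sub_one.norm.eventually_lt_const (by simp)
  obtain ⟨δ, hδ0, hδ⟩ := Metric.eventually_nhds_iff.mp
    (eventually_nhdsWithin_iff.mp (hC.bound.and hM))
  set B : ℝ := ∑ j ∈ J, |c j| * ∑' k, ‖lubichCoeff α k‖ with hB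
  have hB0 : 0 ≤ B := Finset.sum_nonneg fun j _ ↦
    mul_nonneg (abs_nonneg _) (tsum_nonneg fun _ ↦ norm_nonneg _)
  -- `C` serves |ζ| < δ. For |ζ| ≥ δ, |ζ|^α ≤ δ^{-3}|ζ|^{α+3}, and the weighted sum is at most B ≤ B
  -- δ^{-(α+3)}|ζ|^{α+3}.
  refine ⟨max C (1 / δ ^ 3 + B / δ ^ (α + 3)), fun ζ hre ↦ ?_⟩
  have hexp (t : ℝ) : ‖Complex.exp (t * ζ)‖ = 1 := by rw [Complex.norm_exp]; simp [hre]
  have hz : ‖Complex.exp (-ζ)‖ ≤ 1 := by rw [Complex.norm_exp]; simp [hre]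
  rcases eq_or_ne ζ 0 with rfl | hζ
  · have hα0 : (α : ℂ) ≠ 0 := by exact_mod_cast (by linarith : α ≠ 0)
    have hα3 : α + 3 ≠ 0 := by linarith
    simp [lubichSymbol, Complex.zero_cpow hα0, Real.zero_rpow hα3]
  have hn : 0 < ‖ζ‖ := norm_pos_iff.mpr hζ
  have hpow : ‖ζ‖ ^ (α + 3) = ‖ζ‖ ^ α * ‖ζ‖ ^ 3 := by
    rw [Real.rpow_add hn]
    norm_cast
  rcases lt_or_ge ‖ζ‖ δ with hlt | hge
  · obtain ⟨hb, hM1⟩ := hδ (by simpa using hlt) hζ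
    rw [lubichSymbol_exp_neg hre hζ hM1]
    have : ζ ^ (α : ℂ) - ∑ j ∈ J, (c j : ℂ) * (Complex.exp (a j * ζ) *
        (ζ ^ (α : ℂ) * bdfQuotient ζ ^ (α : ℂ))) = -(ζ ^ (α : ℂ) *
        (∑ j ∈ J, (c j : ℂ) * (Complex.exp (a j * ζ) * bdfQuotient ζ ^ (α : ℂ)) - 1)) := by
      rw [mul_sub, Finset.mul_sum, neg_sub, mul_one]
      congr 1
      exact Finset.sum_congr rfl fun j _ ↦ by ring
    rw [this, norm_neg, norm_mul, Complex.norm_cpow_real, hpow]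
    rw [norm_pow] at hb
    calc ‖ζ‖ ^ α * _ ≤ ‖ζ‖ ^ α * (C * ‖ζ‖ ^ 3) := by gcongr
      _ = C * (‖ζ‖ ^ α * ‖ζ‖ ^ 3) := by ring
      _ ≤ _ := by gcongr; exact le_max_left _ _
  · have hs : ‖∑ j ∈ J, (c j : ℂ) * (Complex.exp (a j * ζ) *
        lubichSymbol α (Complex.exp (-ζ)))‖ ≤ B := by
      refine (norm_sum_le _ _).trans (Finset.sum_le_sum fun j _ ↦ ?_)
      rw [norm_mul, norm_mul, hexp, one_mul, Complex.norm_real, Real.norm_eq_abs]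
      gcongr
      exact norm_lubichSymbol_le hα₁ hα₂ hz
    have ha1 : ‖ζ‖ ^ α ≤ 1 / δ ^ 3 * ‖ζ‖ ^ (α + 3) := by
      rw [hpow, div_mul_eq_mul_div, one_mul, le_div_iff₀ (by positivity)]
      gcongr
    have ha2 : B ≤ B / δ ^ (α + 3) * ‖ζ‖ ^ (α + 3) := by
      rw [div_mul_eq_mul_div, le_div_iff₀ (by positivity)]
      gcongr
    calc _ ≤ ‖ζ ^ (α : ℂ)‖ + B := (norm_sub_le _ _).trans (by gcongr)
      _ ≤ (1 / δ ^ 3 + B / δ ^ (α + 3)) * ‖ζ‖ ^ (α + 3) := by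
        rw [Complex.norm_cpow_real, add_mul]
        exact add_le_add ha1 ha2
      _ ≤ _ := by gcongr; exact le_max_right _ _

/-! ### The Laplace transform of a power -/

lemma integrableOn_rpow_mul_exp {γ b : ℝ} (hγ : 0 < γ) (hb : 0 < b) :
    IntegrableOn (fun t : ℝ ↦ t ^ (γ - 1) * Real.exp (-b * t)) (Ioi 0) := by
  simpa using integrableOn_rpow_mul_exp_neg_mul_rpow (p := 1) (s := γ - 1) (by linarith) one_pos hb

lemma aestronglyMeasurable_rpow_mul_cexp (γ : ℝ) (s : ℂ) :
    AEStronglyMeasurable (fun t : ℝ ↦ ((t ^ (γ - 1) : ℝ) : ℂ) * Complex.exp (-(s * t)))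
      (volume.restrict (Ioi 0)) := by
  refine Measurable.aestronglyMeasurable ?_
  fun_prop

lemma norm_rpow_mul_cexp {γ : ℝ} (s : ℂ) {t : ℝ} (ht : 0 < t) :
    ‖((t ^ (γ - 1) : ℝ) : ℂ) * Complex.exp (-(s * t))‖ = t ^ (γ - 1) * Real.exp (-s.re * t) := by
  rw [norm_mul, Complex.norm_real, Complex.norm_exp, Real.norm_of_nonneg (by positivity)]
  simp

lemma integrableOn_rpow_mul_cexp {γ : ℝ} (hγ : 0 < γ) {s : ℂ} (hs : 0 < s.re) :
    IntegrableOn (fun t : ℝ ↦ ((t ^ (γ - 1) : ℝ) : ℂ) * Complex.exp (-(s * t))) (Ioi 0) := by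
  refine (integrableOn_rpow_mul_exp hγ hs).mono' (aestronglyMeasurable_rpow_mul_cexp γ s) ?_
  filter_upwards [ae_restrict_mem measurableSet_Ioi] with t ht
  exact (norm_rpow_mul_cexp s ht).le

lemma differentiableOn_laplace_rpow {γ : ℝ} (hγ : 0 < γ) :
    DifferentiableOn ℂ (fun s : ℂ ↦ ∫ t : ℝ in Ioi 0,
      ((t ^ (γ - 1) : ℝ) : ℂ) * Complex.exp (-(s * t))) {s | 0 < s.re} := by
  intro s₀ (hs₀ : 0 < s₀.re)
  have hU : {s : ℂ | s₀.re / 2 < s.re} ∈ 𝓝 s₀ :=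
    (isOpen_lt continuous_const Complex.continuous_re).mem_nhds (by simp; linarith)
  -- The s-derivative is minus the same integrand with γ + 1 in place of γ; it is dominated
  -- uniformly on Re s > (Re s₀)/2.
  have h := hasDerivAt_integral_of_dominated_loc_of_deriv_le (μ := volume.restrict (Ioi (0 : ℝ)))
    (F := fun (s : ℂ) (t : ℝ) ↦ ((t ^ (γ - 1) : ℝ) : ℂ) * Complex.exp (-(s * t)))
    (F' := fun (s : ℂ) (t : ℝ) ↦ -(((t ^ (γ + 1 - 1) : ℝ) : ℂ) * Complex.exp (-(s * t))))
    (bound := fun t : ℝ ↦ t ^ (γ + 1 - 1) * Real.exp (-(s₀.re / 2) * t)) hU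
    (Eventually.of_forall fun s ↦ aestronglyMeasurable_rpow_mul_cexp γ s)
    (integrableOn_rpow_mul_cexp hγ hs₀)
    (aestronglyMeasurable_rpow_mul_cexp (γ + 1) s₀).neg ?_
    (integrableOn_rpow_mul_exp (by linarith) (by linarith)) ?_
  · exact h.2.differentiableAt.differentiableWithinAt
  · filter_upwards [ae_restrict_mem measurableSet_Ioi] with t (ht : 0 < t) s (hs : s₀.re / 2 < s.re)
    rw [norm_neg, norm_rpow_mul_cexp s ht]
    gcongr
  · filter_upwards [ae_restrict_mem measurableSet_Ioi] with t (ht : 0 < t) s _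
    have h1 : HasDerivAt (fun s : ℂ ↦ -(s * t)) (-(1 * (t : ℂ))) s :=
      ((hasDerivAt_id s).mul_const (t : ℂ)).neg
    convert! (h1.cexp.const_mul ((t ^ (γ - 1) : ℝ) : ℂ)) using 1
    have h2 : t ^ (γ + 1 - 1) = t ^ (γ - 1) * t := by
      rw [← Real.rpow_add_one ht.ne']
      ring_nf
    rw [h2]
    push_cast
    ring

/-- `∫_0^∞ t^(γ-1) e^{-st} dt = Γ(γ) s^{-γ}` in the right half-plane. -/
theorem integral_rpow_mul_cexp {γ : ℝ} (hγ : 0 < γ) {s : ℂ} (hs : 0 < s.re) :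
    ∫ t : ℝ in Ioi 0, ((t ^ (γ - 1) : ℝ) : ℂ) * Complex.exp (-(s * t)) =
      (Real.Gamma γ : ℂ) * s ^ (-γ : ℂ) := by
  have hopen : IsOpen {s : ℂ | 0 < s.re} := isOpen_lt continuous_const Complex.continuous_re
  have hf := (differentiableOn_laplace_rpow hγ).analyticOnNhd hopen
  have hg : DifferentiableOn ℂ (fun s : ℂ ↦ (Real.Gamma γ : ℂ) * s ^ (-γ : ℂ)) {s | 0 < s.re} := by
    intro z (hz : 0 < z.re)
    exact ((DifferentiableAt.cpow_const (differentiableAt_id) (Or.inl hz)).const_mul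
      _).differentiableWithinAt
  have hreal : ∀ r : ℝ, 0 < r → ∫ t : ℝ in Ioi 0, ((t ^ (γ - 1) : ℝ) : ℂ) *
      Complex.exp (-((r : ℂ) * t)) = (Real.Gamma γ : ℂ) * (r : ℂ) ^ (-γ : ℂ) := by
    intro r hr
    have h := Real.integral_rpow_mul_exp_neg_mul_Ioi hγ hr
    have h2 := congrArg ((↑) : ℝ → ℂ) h
    rw [← integral_complex_ofReal] at h2
    push_cast at h2 ⊢
    rw [h2, mul_comm, Complex.ofReal_cpow (by positivity), Complex.cpow_neg, one_div]
    push_cast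
    rw [← Complex.ofReal_inv, ← Complex.ofReal_cpow (by positivity),
      ← Complex.ofReal_cpow (by positivity), Real.inv_rpow hr.le]
    push_cast
    rfl
  -- Identity theorem: both sides are analytic on the half-plane and agree at real points
  -- accumulating at 1.
  have hfreq : ∃ᶠ z in 𝓝[≠] (1 : ℂ), ∫ t : ℝ in Ioi 0, ((t ^ (γ - 1) : ℝ) : ℂ) *
      Complex.exp (-(z * t)) = (Real.Gamma γ : ℂ) * z ^ (-γ : ℂ) := by
    have ht : Tendsto (fun r : ℝ ↦ (r : ℂ)) (𝓝[>] 1) (𝓝[≠] 1) := by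
      refine tendsto_nhdsWithin_iff.mpr ⟨?_, ?_⟩
      · have := Complex.continuous_ofReal.tendsto 1
        exact (by simpa using this : Tendsto _ _ (𝓝 (1 : ℂ))).mono_left nhdsWithin_le_nhds
      · filter_upwards [self_mem_nhdsWithin] with r (hr : 1 < r)
        simpa using hr.ne'
    refine ht.frequently (Eventually.frequently ?_)
    filter_upwards [self_mem_nhdsWithin] with r (hr : 1 < r)
    exact hreal r (by linarith)
  exact AnalyticOnNhd.eqOn_of_preconnected_of_frequently_eq hf (hg.analyticOnNhd hopen)
    (convex_halfSpace_re_gt 0).isPreconnected (by simp : (1 : ℂ) ∈ {s : ℂ | 0 < s.re}) hfreq hs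

/-! ### The fractional integral in the frequency domain -/

/-- The angular frequency `2πiω` on the imaginary axis. -/
def freq (ω : ℝ) : ℂ := 2 * Real.pi * Complex.I * ω

@[simp] lemma freq_re (ω : ℝ) : (freq ω).re = 0 := by simp [freq]

lemma freq_im (ω : ℝ) : (freq ω).im = 2 * Real.pi * ω := by simp [freq]

lemma freq_ne_zero {ω : ℝ} (hω : ω ≠ 0) : freq ω ≠ 0 := by
  simp [freq, hω, Real.pi_ne_zero, Complex.I_ne_zero]

lemma norm_freq (ω : ℝ) : ‖freq ω‖ = 2 * Real.pi * |ω| := by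
  simp [freq, abs_of_pos Real.pi_pos]

@[fun_prop] lemma continuous_freq : Continuous freq := by unfold freq; fun_prop

@[fun_prop] lemma measurable_freq : Measurable freq := continuous_freq.measurable

lemma norm_cexp_freq_mul (ω x : ℝ) : ‖Complex.exp (freq ω * x)‖ = 1 := by
  rw [Complex.norm_exp]
  simp

lemma fourierInv_eq_integral (f : ℝ → ℂ) (x : ℝ) :
    𝓕⁻ f x = ∫ ω, Complex.exp (freq ω * x) * f ω := by
  rw [Real.fourierInv_eq']
  refine integral_congr_ae (Eventually.of_forall fun ω ↦ ?_)
  simp only [smul_eq_mul, freq]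
  congr 2
  simp
  ring

lemma integrable_cexp_mul {f : ℝ → ℂ} (hf : Integrable f) (x : ℝ) :
    Integrable fun ω ↦ Complex.exp (freq ω * x) * f ω := by
  refine hf.bdd_mul (c := 1) (Measurable.aestronglyMeasurable (by fun_prop)) ?_
  exact Eventually.of_forall fun ω ↦ (norm_cexp_freq_mul ω x).le

lemma norm_fourierInv_le (f : ℝ → ℂ) (x : ℝ) : ‖𝓕⁻ f x‖ ≤ ∫ ω, ‖f ω‖ := by
  rw [fourierInv_eq_integral]
  refine (norm_integral_le_integral_norm _).trans_eq ?_
  simp [norm_cexp_freq_mul]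

lemma exists_norm_fourier_le (f : ℝ → ℂ) : ∃ B, ∀ ω, ‖𝓕 f ω‖ ≤ B :=
  ⟨∫ x, ‖f x‖, fun ω ↦ by
    simpa [Real.fourierInv_eq_fourier_neg] using norm_fourierInv_le f (-ω)⟩

lemma continuous_fourier {f : ℝ → ℂ} (hf : Integrable f) :
    Continuous (𝓕 f) :=
  VectorFourier.fourierIntegral_continuous Real.continuous_fourierChar (by fun_prop) hf

/-- Near 0 the singularity |ω|^{-γ} is integrable and `f` is bounded; for |ω| ≥ 1 the power is
bounded and `f` is integrable. -/
lemma integrable_freq_cpow_mul {f : ℝ → ℂ} (hf : Integrable f) {B : ℝ} (hB : ∀ ω, ‖f ω‖ ≤ B)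
    {γ : ℝ} (hγ₀ : 0 < γ) (hγ₁ : γ < 1) :
    Integrable fun ω ↦ freq ω ^ (-γ : ℂ) * f ω := by
  have hnorm (ω : ℝ) : ‖freq ω ^ (-γ : ℂ)‖ = (2 * Real.pi) ^ (-γ) * ‖ω‖ ^ (-γ) := by
    rw [← Complex.ofReal_neg, Complex.norm_cpow_real, norm_freq,
      Real.mul_rpow (by positivity) (abs_nonneg _), Real.norm_eq_abs]
  have hmeas : AEStronglyMeasurable (fun ω ↦ freq ω ^ (-γ : ℂ) * f ω) :=
    (Measurable.aestronglyMeasurable (by fun_prop)).mul hf.1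
  have hball : IntegrableOn (fun ω ↦ freq ω ^ (-γ : ℂ) * f ω) (Metric.ball 0 1) := by
    refine integrableOn_ball_of_norm_le_rpow (C := (2 * Real.pi) ^ (-γ) * B) (α := γ)
      (by simp) (by simpa) (Eventually.of_forall fun ω ↦ ?_) hmeas
    rw [norm_mul, hnorm, mul_right_comm]
    gcongr
    exact hB ω
  have hcompl : IntegrableOn (fun ω ↦ freq ω ^ (-γ : ℂ) * f ω) (Metric.ball 0 1)ᶜ := by
    refine Integrable.mono' (hf.norm.const_mul ((2 * Real.pi) ^ (-γ))).integrableOn hmeas.restrict ?_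
    filter_upwards [ae_restrict_mem Metric.isOpen_ball.measurableSet.compl] with ω hω
    have h1 : 1 ≤ ‖ω‖ := by simpa using hω
    rw [norm_mul, hnorm]
    gcongr
    exact mul_le_of_le_one_right (by positivity)
      (Real.rpow_le_one_of_one_le_of_nonpos h1 (by linarith))
  simpa using hball.union hcompl

lemma leftRLIntegral_eq (γ : ℝ) (u : ℝ → ℂ) (x : ℝ) :
    leftRLIntegral γ u x = ((1 / Real.Gamma γ : ℝ) : ℂ) *
      ∫ t in Ioi (0 : ℝ), ((t ^ (γ - 1) : ℝ) : ℂ) * u (x - t) := by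
  rw [leftRLIntegral, ← integral_indicator measurableSet_Iio, ← integral_indicator measurableSet_Ioi,
    ← integral_sub_left_eq_self _ volume x]
  congr 2
  ext t
  by_cases ht : 0 < t
  · simp [indicator, ht, leftRLIntegrand]
  · simp [indicator, ht]

lemma integrableOn_comp_sub {γ : ℝ} {u : ℝ → ℂ} {x : ℝ}
    (h : IntegrableOn (leftRLIntegrand γ u x) (Iio x)) :
    IntegrableOn (fun t ↦ ((t ^ (γ - 1) : ℝ) : ℂ) * u (x - t)) (Ioi 0) := by
  rw [← integrable_indicator_iff measurableSet_Iio] at h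
  rw [← integrable_indicator_iff measurableSet_Ioi]
  convert! h.comp_sub_left x using 1
  ext t
  by_cases ht : 0 < t
  · simp [indicator, ht, leftRLIntegrand]
  · simp [indicator, ht]

/-- The exponentially damped fractional integral of an inverse Fourier transform. -/
lemma integral_rpow_mul_cexp_mul_fourierInv {γ : ℝ} (hγ : 0 < γ) {ε : ℝ} (hε : 0 < ε)
    {f : ℝ → ℂ} (hf : Integrable f) (x : ℝ) :
    ∫ t in Ioi (0 : ℝ), ((t ^ (γ - 1) : ℝ) : ℂ) * Complex.exp (-(ε * t)) * 𝓕⁻ f (x - t) =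
      (Real.Gamma γ : ℂ) *
        ∫ ω, (ε + freq ω) ^ (-γ : ℂ) * (Complex.exp (freq ω * x) * f ω) := by
  -- The damping e^{-εt} is what makes the double integral absolutely convergent, so that Fubini
  -- applies.
  have hint : Integrable (Function.uncurry fun (t ω : ℝ) ↦
      Complex.exp (-(freq ω * t)) * ((((t ^ (γ - 1) : ℝ) : ℂ) * Complex.exp (-(ε * t))) *
        (Complex.exp (freq ω * x) * f ω))) ((volume.restrict (Ioi (0 : ℝ))).prod volume) := by
    have h := (integrableOn_rpow_mul_cexp hγ (s := (ε : ℂ)) (by simpa)).mul_prod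
      (integrable_cexp_mul hf x)
    refine h.bdd_mul (c := 1) (Measurable.aestronglyMeasurable (by fun_prop)) ?_
    exact Eventually.of_forall fun p ↦ by rw [Complex.norm_exp]; simp
  calc _ = ∫ t in Ioi (0 : ℝ), ∫ ω, Complex.exp (-(freq ω * t)) *
        ((((t ^ (γ - 1) : ℝ) : ℂ) * Complex.exp (-(ε * t))) * (Complex.exp (freq ω * x) * f ω)) := by
        congr 1
        ext t
        rw [fourierInv_eq_integral, ← integral_const_mul]
        congr 1
        ext ω
        have : Complex.exp (freq ω * ((x - t : ℝ) : ℂ)) =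
            Complex.exp (-(freq ω * t)) * Complex.exp (freq ω * x) := by
          rw [← Complex.exp_add]
          congr 1
          push_cast
          ring
        rw [this]
        ring
    _ = ∫ ω, ∫ t in Ioi (0 : ℝ), Complex.exp (-(freq ω * t)) *
        ((((t ^ (γ - 1) : ℝ) : ℂ) * Complex.exp (-(ε * t))) * (Complex.exp (freq ω * x) * f ω)) :=
        integral_integral_swap hint
    _ = _ := by
        rw [← integral_const_mul]
        congr 1
        ext ω
        rw [← mul_assoc, ← integral_rpow_mul_cexp hγ (s := ε + freq ω) (by simpa),
          ← integral_mul_const]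
        congr 1
        ext t
        have : Complex.exp (-((ε + freq ω) * t)) =
            Complex.exp (-(freq ω * t)) * Complex.exp (-(ε * t)) := by
          rw [← Complex.exp_add]
          congr 1
          ring
        rw [this]
        ring

/-- Fractional integration multiplies the Fourier transform by `(2πiω)^{-γ}`. -/
theorem leftRLIntegral_fourierInv {γ : ℝ} (hγ₀ : 0 < γ) {f : ℝ → ℂ} (hf : Integrable f)
    (hfγ : Integrable fun ω ↦ freq ω ^ (-γ : ℂ) * f ω) {x : ℝ}
    (hx : IntegrableOn (leftRLIntegrand γ (𝓕⁻ f) x) (Iio x)) :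
    leftRLIntegral γ (𝓕⁻ f) x = 𝓕⁻ (fun ω ↦ freq ω ^ (-γ : ℂ) * f ω) x := by
  have hG : (Real.Gamma γ : ℂ) ≠ 0 := by exact_mod_cast (Real.Gamma_pos_of_pos hγ₀).ne'
  have hx' := integrableOn_comp_sub hx
  have hpos : ∀ᶠ ε : ℝ in 𝓝[>] 0, 0 < ε := self_mem_nhdsWithin
  have hto (F : ℝ → ℂ) (hF : Continuous F) : Tendsto F (𝓝[>] 0) (𝓝 (F 0)) :=
    (hF.tendsto 0).mono_left nhdsWithin_le_nhds
  -- Let ε → 0 in the damped identity. The t-integral is dominated by the absolutely convergent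
  -- fractional integral; the ω-integral by |ζ|^{-γ}|f|, since |ε + ζ| ≥ |ζ|.
  have h1 : Tendsto (fun ε : ℝ ↦ ∫ t in Ioi (0 : ℝ),
      ((t ^ (γ - 1) : ℝ) : ℂ) * Complex.exp (-(ε * t)) * 𝓕⁻ f (x - t)) (𝓝[>] 0)
      (𝓝 (∫ t in Ioi (0 : ℝ), ((t ^ (γ - 1) : ℝ) : ℂ) * 𝓕⁻ f (x - t))) := by
    refine tendsto_integral_filter_of_dominated_convergence
      (fun t ↦ ‖((t ^ (γ - 1) : ℝ) : ℂ) * 𝓕⁻ f (x - t)‖) (Eventually.of_forall fun ε ↦ ?_) ?_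
      hx'.norm ?_
    · have hm : AEStronglyMeasurable (fun t : ℝ ↦ Complex.exp (-(ε * t)))
          (volume.restrict (Ioi 0)) := Measurable.aestronglyMeasurable (by fun_prop)
      exact (hm.mul hx'.1).congr (Eventually.of_forall fun t ↦ by simp; ring)
    · filter_upwards [hpos] with ε hε
      filter_upwards [ae_restrict_mem measurableSet_Ioi] with t (ht : 0 < t)
      have : ‖Complex.exp (-(ε * t))‖ ≤ 1 := by
        rw [Complex.norm_exp]
        simpa using (mul_pos hε ht).le
      rw [mul_right_comm, norm_mul _ (Complex.exp _)]
      exact mul_le_of_le_one_right (norm_nonneg _) this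
    · refine Eventually.of_forall fun t ↦ ?_
      simpa using hto (fun ε : ℝ ↦ ((t ^ (γ - 1) : ℝ) : ℂ) * Complex.exp (-(ε * t)) * 𝓕⁻ f (x - t))
        (by fun_prop)
  have h2 : Tendsto (fun ε : ℝ ↦ (Real.Gamma γ : ℂ) *
      ∫ ω, (ε + freq ω) ^ (-γ : ℂ) * (Complex.exp (freq ω * x) * f ω)) (𝓝[>] 0)
      (𝓝 ((Real.Gamma γ : ℂ) * ∫ ω, freq ω ^ (-γ : ℂ) * (Complex.exp (freq ω * x) * f ω))) := by
    refine Tendsto.const_mul _ (tendsto_integral_filter_of_dominated_convergence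
      (fun ω ↦ ‖freq ω ^ (-γ : ℂ) * f ω‖) (Eventually.of_forall fun ε ↦ ?_) ?_ hfγ.norm ?_)
    · exact (Measurable.aestronglyMeasurable (by fun_prop)).mul (integrable_cexp_mul hf x).1
    · filter_upwards with ε
      filter_upwards [Measure.ae_ne volume (0 : ℝ)] with ω hω
      rw [norm_mul, norm_mul, norm_mul, norm_cexp_freq_mul, one_mul, ← Complex.ofReal_neg,
        Complex.norm_cpow_real, Complex.norm_cpow_real]
      have hle : ‖freq ω‖ ≤ ‖(ε : ℂ) + freq ω‖ := by
        have := Complex.abs_im_le_norm ((ε : ℂ) + freq ω)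
        rw [Complex.add_im, Complex.ofReal_im, zero_add, freq_im] at this
        rwa [norm_freq, ← abs_of_pos Real.two_pi_pos, ← abs_mul]
      exact mul_le_mul_of_nonneg_right (Real.rpow_le_rpow_of_nonpos
        (norm_pos_iff.mpr (freq_ne_zero hω)) hle (by linarith)) (norm_nonneg _)
    · filter_upwards [Measure.ae_ne volume (0 : ℝ)] with ω hω
      have hc : ContinuousAt (fun ε : ℝ ↦ ((ε : ℂ) + freq ω) ^ (-γ : ℂ)) 0 := by
        refine ContinuousAt.cpow (by fun_prop) (by fun_prop) (Or.inr ?_)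
        simp [freq_im, hω, Real.pi_ne_zero]
      have := (hc.tendsto.mono_left (nhdsWithin_le_nhds (s := Ioi 0)))
      simp only [Complex.ofReal_zero, zero_add] at this
      exact this.mul_const _
  have h3 := tendsto_nhds_unique (h1.congr' ?_) h2
  · rw [leftRLIntegral_eq, h3, fourierInv_eq_integral, ← mul_assoc]
    push_cast
    rw [one_div_mul_cancel hG, one_mul]
    congr 1
    ext ω
    ring
  · filter_upwards [hpos] with ε hε
    exact integral_rpow_mul_cexp_mul_fourierInv hγ₀ hε hf x

/-! ### Fourier inversion almost everywhere -/

lemma integral_fourier_mul_eq {f g : ℝ → ℂ} (hf : Integrable f) (hg : Integrable g) :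
    ∫ x, 𝓕 f x * g x = ∫ x, f x * 𝓕 g x := by
  simpa using! VectorFourier.integral_fourierIntegral_smul_eq_flip (L := innerₗ ℝ)
    Real.continuous_fourierChar continuous_inner hf hg

lemma integral_fourierInv_mul_eq {f g : ℝ → ℂ} (hf : Integrable f) (hg : Integrable g) :
    ∫ x, 𝓕⁻ f x * g x = ∫ x, f x * 𝓕⁻ g x := by
  rw [Real.fourierInv_eq_fourier_comp_neg g, ← integral_fourier_mul_eq hf hg.comp_neg,
    ← integral_neg_eq_self]
  simp [Real.fourierInv_eq_fourier_neg]

/-- Fourier inversion almost everywhere, without continuity. -/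
theorem ae_eq_fourierInv_fourier {f : ℝ → ℂ} (hf : Integrable f) (hf' : Integrable (𝓕 f)) :
    f =ᵐ[volume] 𝓕⁻ (𝓕 f) := by
  have hcont : Continuous (𝓕⁻ (𝓕 f)) := by
    rw [Real.fourierInv_eq_fourier_comp_neg]
    exact continuous_fourier hf'.comp_neg
  -- Test against smooth compactly supported functions: inversion is known for these as Schwartz
  -- functions, and the multiplication formula moves both transforms across.
  refine ae_eq_of_integral_contDiff_smul_eq hf.locallyIntegrable hcont.locallyIntegrable
    fun g hg hgs ↦ ?_
  let ψ : SchwartzMap ℝ ℂ := HasCompactSupport.toSchwartzMap (f := fun x ↦ ((g x : ℝ) : ℂ))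
    (hgs.comp_left (g := fun r : ℝ ↦ (r : ℂ)) (by simp)) (Complex.ofRealCLM.contDiff.comp hg)
  have hψ (x : ℝ) : ψ x = (g x : ℂ) := rfl
  have h1 : 𝓕 (𝓕⁻ (ψ : ℝ → ℂ)) = ψ := by
    rw [← SchwartzMap.fourierInv_coe, ← SchwartzMap.fourier_coe,
      FourierTransform.fourier_fourierInv_eq]
  have h2 : Integrable (𝓕⁻ (ψ : ℝ → ℂ)) := by
    rw [← SchwartzMap.fourierInv_coe]
    exact (𝓕⁻ ψ).integrable
  calc ∫ x, g x • f x = ∫ x, 𝓕 (𝓕⁻ (ψ : ℝ → ℂ)) x * f x := by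
        rw [h1]; simp [hψ]
    _ = ∫ x, 𝓕⁻ (ψ : ℝ → ℂ) x * 𝓕 f x := integral_fourier_mul_eq h2 hf
    _ = ∫ x, ψ x * 𝓕⁻ (𝓕 f) x := integral_fourierInv_mul_eq ψ.integrable hf'
    _ = _ := by simp [hψ]

/-- The difference has transform 0, which is integrable, so almost everywhere inversion applies to
it. -/
lemma ae_eq_of_fourierInv_eq {f g : ℝ → ℂ} (hf : Integrable f) (hg : Integrable g)
    (h : 𝓕⁻ f = 𝓕⁻ g) : f =ᵐ[volume] g := by
  have h0 : 𝓕 (f - g) = 0 := by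
    ext x
    have hx := congrFun h (-x)
    rw [fourierInv_eq_integral, fourierInv_eq_integral, ← sub_eq_zero,
      ← integral_sub (integrable_cexp_mul hf _) (integrable_cexp_mul hg _)] at hx
    rw [Pi.zero_apply, ← neg_neg x, ← Real.fourierInv_eq_fourier_neg, fourierInv_eq_integral]
    simpa only [Pi.sub_apply, mul_sub] using hx
  have h1 := ae_eq_fourierInv_fourier (hf.sub hg) (by rw [h0]; exact integrable_zero _ _ _)
  filter_upwards [h1] with x hx
  rw [h0, fourierInv_eq_integral] at hx
  simpa [sub_eq_zero] using hx

/-- An integrable derivative that agrees almost everywhere with a continuous function agrees with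
it everywhere. -/
lemma deriv_eq_of_ae_eq {G v : ℝ → ℂ} (hG : Differentiable ℝ G) (hint : Integrable (deriv G))
    (hv : Continuous v) (h : deriv G =ᵐ[volume] v) : deriv G = v := by
  -- The fundamental theorem of calculus needs only differentiability everywhere and an integrable
  -- derivative, so `G` is a primitive of the continuous `v`.
  have hFTC (y : ℝ) : G y = G 0 + ∫ t in (0 : ℝ)..y, v t := by
    rw [← intervalIntegral.integral_congr_ae (f := deriv G)
      (by filter_upwards [h] with t ht _ using ht),
      intervalIntegral.integral_eq_sub_of_hasDerivAt (fun x _ ↦ (hG x).hasDerivAt)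
        hint.intervalIntegrable]
    ring
  ext x
  rw [funext hFTC, deriv_const_add]
  exact (intervalIntegral.integral_hasDerivAt_right (hv.intervalIntegrable _ _)
    hv.aestronglyMeasurable.stronglyMeasurableAtFilter hv.continuousAt).deriv

/-! ### Finite differences of inverse Fourier transforms -/

/-- The average `∫_0^1 e^{2πiωt} dt`. -/
def freqMean (ω : ℝ) : ℂ := ∫ t in Ioc (0 : ℝ) 1, Complex.exp (freq ω * t)

lemma freq_mul_freqMean (ω : ℝ) : freq ω * freqMean ω = Complex.exp (freq ω) - 1 := by
  rcases eq_or_ne ω 0 with rfl | hω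
  · simp [freq]
  · rw [freqMean, ← intervalIntegral.integral_of_le zero_le_one,
      integral_exp_mul_complex (freq_ne_zero hω), mul_div_cancel₀ _ (freq_ne_zero hω)]
    simp

lemma norm_freqMean_le (ω : ℝ) : ‖freqMean ω‖ ≤ 1 := by
  refine (norm_integral_le_integral_norm _).trans_eq ?_
  simp [norm_cexp_freq_mul]

lemma stronglyMeasurable_freqMean : StronglyMeasurable freqMean := by
  refine StronglyMeasurable.integral_prod_right (f := fun ω (t : ℝ) ↦ Complex.exp (freq ω * t)) ?_
  exact Continuous.stronglyMeasurable (by fun_prop)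

lemma integrable_freqMean_pow_mul {a : ℝ → ℂ} (ha : Integrable a) (n : ℕ) :
    Integrable fun ω ↦ freqMean ω ^ n * a ω :=
  ha.bdd_mul (c := 1) (stronglyMeasurable_freqMean.pow n).aestronglyMeasurable
    (Eventually.of_forall fun ω ↦ by
      rw [norm_pow]; exact pow_le_one₀ (norm_nonneg _) (norm_freqMean_le ω))

lemma continuous_fourierInv {a : ℝ → ℂ} (ha : Integrable a) : Continuous (𝓕⁻ a) := by
  rw [Real.fourierInv_eq_fourier_comp_neg]
  exact continuous_fourier ha.comp_neg

/-- Integrate the derivative over [x, x+1] and use Fubini. Unlike division by ζ, the multiplier (e^ζ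
- 1)/ζ is bounded, so integrability is preserved. -/
lemma fwdDiff_eq_fourierInv {a g : ℝ → ℂ} (ha : Integrable a)
    (hg : ∀ x, HasDerivAt g (𝓕⁻ a x) x) :
    fwdDiff (1 : ℝ) g = 𝓕⁻ fun ω ↦ freqMean ω * a ω := by
  ext x
  have hint : Integrable (Function.uncurry fun (t ω : ℝ) ↦ Complex.exp (freq ω * t) *
      (Complex.exp (freq ω * x) * a ω)) ((volume.restrict (Ioc (0 : ℝ) 1)).prod volume) := by
    have h := (integrable_const (μ := volume.restrict (Ioc (0 : ℝ) 1)) (1 : ℂ)).mul_prod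
      (integrable_cexp_mul ha x)
    simp only [one_mul] at h
    refine h.bdd_mul (c := 1) (Measurable.aestronglyMeasurable (by fun_prop)) ?_
    exact Eventually.of_forall fun p ↦ (norm_cexp_freq_mul p.2 p.1).le
  calc g (x + 1) - g x = ∫ t in (0 : ℝ)..1, 𝓕⁻ a (t + x) := by
        rw [intervalIntegral.integral_comp_add_right (fun t ↦ 𝓕⁻ a t),
          intervalIntegral.integral_eq_sub_of_hasDerivAt (fun y _ ↦ hg y)
            ((continuous_fourierInv ha).intervalIntegrable _ _), zero_add, add_comm]
    _ = ∫ t in Ioc (0 : ℝ) 1, ∫ ω, Complex.exp (freq ω * t) * (Complex.exp (freq ω * x) * a ω) := by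
        rw [intervalIntegral.integral_of_le zero_le_one]
        congr 1
        ext t
        rw [fourierInv_eq_integral]
        congr 1
        ext ω
        rw [← mul_assoc, ← Complex.exp_add]
        congr 2
        push_cast
        ring
    _ = ∫ ω, ∫ t in Ioc (0 : ℝ) 1, Complex.exp (freq ω * t) * (Complex.exp (freq ω * x) * a ω) :=
        integral_integral_swap hint
    _ = _ := by
        rw [fourierInv_eq_integral]
        congr 1
        ext ω
        rw [integral_mul_const, ← freqMean]
        ring

lemma hasDerivAt_fwdDiff_iter {g g' : ℝ → ℂ} (hg : ∀ x, HasDerivAt g (g' x) x) (n : ℕ) (x : ℝ) :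
    HasDerivAt ((fwdDiff (1 : ℝ))^[n] g) ((fwdDiff (1 : ℝ))^[n] g' x) x := by
  induction n generalizing g g' with
  | zero => exact hg x
  | succ n ih =>
    rw [Function.iterate_succ_apply, Function.iterate_succ_apply]
    exact ih fun y ↦ ((hg (y + 1)).comp_add_const y 1).sub (hg y)

lemma fwdDiff_iter_eq_fourierInv {a : ℝ → ℂ} (ha : Integrable a) (n : ℕ) {g : ℝ → ℂ}
    (hg : ∀ k < n, Differentiable ℝ (iteratedDeriv k g)) (hn : iteratedDeriv n g = 𝓕⁻ a) :
    (fwdDiff (1 : ℝ))^[n] g = 𝓕⁻ fun ω ↦ freqMean ω ^ n * a ω := by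
  induction n generalizing g with
  | zero => simpa using hn
  | succ n ih =>
    have h := ih (g := deriv g) (fun k hk ↦ by
      rw [← iteratedDeriv_succ']; exact hg (k + 1) (by omega)) (by rw [← iteratedDeriv_succ', hn])
    have hd : ∀ x, HasDerivAt g (deriv g x) x := fun x ↦
      (by simpa using hg 0 (Nat.succ_pos n) : Differentiable ℝ g).differentiableAt.hasDerivAt
    rw [Function.iterate_succ_apply', fwdDiff_eq_fourierInv (integrable_freqMean_pow_mul ha n)
      fun x ↦ by simpa only [h] using hasDerivAt_fwdDiff_iter hd n x]
    congr 1
    ext ω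
    ring

lemma integrable_cexp_sub_one_pow_mul {b : ℝ → ℂ} (hb : Integrable b) (n : ℕ) :
    Integrable fun ω ↦ (Complex.exp (freq ω) - 1) ^ n * b ω := by
  refine hb.bdd_mul (c := 2 ^ n) (Measurable.aestronglyMeasurable (by fun_prop)) ?_
  refine Eventually.of_forall fun ω ↦ ?_
  rw [norm_pow]
  gcongr
  refine (norm_sub_le _ _).trans_eq ?_
  rw [Complex.norm_exp]
  norm_num

lemma fwdDiff_iter_fourierInv {b : ℝ → ℂ} (hb : Integrable b) (n : ℕ) :
    (fwdDiff (1 : ℝ))^[n] (𝓕⁻ b) = 𝓕⁻ fun ω ↦ (Complex.exp (freq ω) - 1) ^ n * b ω := by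
  induction n with
  | zero => simp
  | succ n ih =>
    rw [Function.iterate_succ_apply', ih]
    ext x
    have h := integrable_cexp_sub_one_pow_mul hb n
    rw [fwdDiff, fourierInv_eq_integral, fourierInv_eq_integral, fourierInv_eq_integral,
      ← integral_sub (integrable_cexp_mul h _) (integrable_cexp_mul h _)]
    congr 1
    ext ω
    have : Complex.exp (freq ω * ((x + 1 : ℝ) : ℂ)) =
        Complex.exp (freq ω * x) * Complex.exp (freq ω) := by
      rw [← Complex.exp_add]
      congr 1
      push_cast
      ring
    rw [this]
    ring

lemma ae_cexp_freq_ne_one : ∀ᵐ ω : ℝ, Complex.exp (freq ω) ≠ 1 := by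
  have hc : (range ((↑) : ℤ → ℝ)).Countable := countable_range _
  filter_upwards [hc.ae_notMem volume] with ω hω h
  obtain ⟨n, hn⟩ := Complex.exp_eq_one_iff.mp h
  refine hω ⟨n, ?_⟩
  have := congrArg Complex.im hn
  rw [freq_im] at this
  simp at this
  nlinarith [Real.pi_pos]

/-- If the `n`-th derivative of `𝓕⁻ b` is `𝓕⁻ a`, then `a = (2πiω)^n b`. -/
theorem ae_eq_freq_pow_mul {a b : ℝ → ℂ} (ha : Integrable a) (hb : Integrable b) {n : ℕ}
    (hd : ∀ k < n, Differentiable ℝ (iteratedDeriv k (𝓕⁻ b)))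
    (hn : iteratedDeriv n (𝓕⁻ b) = 𝓕⁻ a) : a =ᵐ[volume] fun ω ↦ freq ω ^ n * b ω := by
  -- The n-th difference is computed from the n-th derivative and directly, giving ((e^ζ - 1)/ζ)^n a
  -- = (e^ζ - 1)^n b. The common factor cancels off the integers.
  have h := ae_eq_of_fourierInv_eq (integrable_freqMean_pow_mul ha n)
    (integrable_cexp_sub_one_pow_mul hb n)
    ((fwdDiff_iter_eq_fourierInv ha n hd hn).symm.trans (fwdDiff_iter_fourierInv hb n))
  filter_upwards [h, ae_cexp_freq_ne_one] with ω hω h1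
  have hE : freqMean ω ≠ 0 := by
    intro h0
    have := freq_mul_freqMean ω
    rw [h0, mul_zero] at this
    exact h1 (sub_eq_zero.mp this.symm)
  rw [← freq_mul_freqMean, mul_pow, mul_comm (freq ω ^ n), mul_assoc] at hω
  exact mul_left_cancel₀ (pow_ne_zero n hE) hω

lemma hasDerivAt_fourierInv {f : ℝ → ℂ} (hf : Integrable f)
    (hf' : Integrable fun ω ↦ freq ω * f ω) (x : ℝ) :
    HasDerivAt (𝓕⁻ f) (𝓕⁻ (fun ω ↦ freq ω * f ω) x) x := by
  have hπ : (2 * (Real.pi : ℂ) * Complex.I) ≠ 0 := Complex.two_pi_I_ne_zero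
  have hint : Integrable fun ω : ℝ ↦ ω • f ω := by
    refine (hf'.const_mul (2 * (Real.pi : ℂ) * Complex.I)⁻¹).congr (Eventually.of_forall fun ω ↦ ?_)
    simp only [freq, Complex.real_smul]
    field_simp
  have h := (Real.hasDerivAt_fourier hf hint (-x)).scomp x (hasDerivAt_neg x)
  have e : 𝓕⁻ f = 𝓕 f ∘ Neg.neg := funext fun y ↦ Real.fourierInv_eq_fourier_neg f y
  rw [e, Real.fourierInv_eq_fourier_neg]
  convert! h using 1
  rw [neg_one_smul, Real.fourier_eq', Real.fourier_eq', ← integral_neg]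
  congr 1
  ext ω
  simp only [freq, smul_eq_mul]
  ring

/-! ### The Lubich operators in the frequency domain -/

lemma summable_lubichTerm {α : ℝ} (hα₁ : 1 < α) (hα₂ : α < 2) {u : ℝ → ℂ} {B : ℝ}
    (hB : ∀ y, ‖u y‖ ≤ B) (m : ℤ) (h x : ℝ) : Summable (lubichTerm α m h u x) := by
  refine Summable.of_norm_bounded ((summable_norm_lubichCoeff hα₁ hα₂).mul_right B) fun k ↦ ?_
  rw [lubichTerm, norm_mul, Complex.norm_real]
  gcongr
  exact hB _

/-- The Fourier multiplier `h^{-α} e^{2πiωmh} W(e^{-2πiωh})` of `_L A_m`. -/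
def lubichMultiplier (α : ℝ) (m : ℤ) (h ω : ℝ) : ℂ :=
  ((1 / h ^ α : ℝ) : ℂ) * (Complex.exp ((m : ℝ) * (freq ω * h)) *
    lubichSymbol α (Complex.exp (-(freq ω * h))))

/-- Σ|q_k| < ∞ and integrability of `f` allow exchanging sum and integral; a shift by -kh multiplies
by e^{-khζ}, so the inner sum is W on the unit circle. -/
lemma integrable_and_lubichOp_fourierInv {α : ℝ} (hα₁ : 1 < α) (hα₂ : α < 2) {f : ℝ → ℂ}
    (hf : Integrable f) (m : ℤ) (h x : ℝ) :
    Integrable (fun ω ↦ Complex.exp (freq ω * x) * (lubichMultiplier α m h ω * f ω)) ∧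
    lubichOp α m h (𝓕⁻ f) x =
      ∫ ω, Complex.exp (freq ω * x) * (lubichMultiplier α m h ω * f ω) := by
  set T : ℕ → ℝ → ℂ := fun k ω ↦ (lubichCoeff α k : ℂ) *
    (Complex.exp (freq ω * ((x - ((k : ℝ) - m) * h : ℝ) : ℂ)) * f ω) with hT
  have hTi (k : ℕ) : Integrable (T k) := (integrable_cexp_mul hf _).const_mul _
  have hTn (k : ℕ) (ω : ℝ) : ‖T k ω‖ = ‖lubichCoeff α k‖ * ‖f ω‖ := by
    rw [hT, norm_mul, norm_mul, norm_cexp_freq_mul, one_mul, Complex.norm_real]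
  have hsum := summable_norm_lubichCoeff hα₁ hα₂
  have hsT : Summable fun k ↦ ∫ ω, ‖T k ω‖ := by
    simp only [hTn, integral_const_mul]
    exact hsum.mul_right _
  have hz (ω : ℝ) : ‖Complex.exp (-(freq ω * h))‖ ≤ 1 := by
    rw [Complex.norm_exp]
    simp
  have hpt (ω : ℝ) : ((1 / h ^ α : ℝ) : ℂ) * ∑' k, T k ω =
      Complex.exp (freq ω * x) * (lubichMultiplier α m h ω * f ω) := by
    have hk (k : ℕ) : T k ω = Complex.exp (freq ω * x) * Complex.exp ((m : ℝ) * (freq ω * h)) *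
        f ω * ((lubichCoeff α k : ℂ) * Complex.exp (-(freq ω * h)) ^ k) := by
      have : Complex.exp (freq ω * ((x - ((k : ℝ) - m) * h : ℝ) : ℂ)) =
          Complex.exp (freq ω * x) * Complex.exp ((m : ℝ) * (freq ω * h)) *
            Complex.exp (-(freq ω * h)) ^ k := by
        rw [← Complex.exp_nat_mul, ← Complex.exp_add, ← Complex.exp_add]
        congr 1
        push_cast
        ring
      rw [hT]
      simp only
      rw [this]
      ring
    simp only [hk]
    rw [tsum_mul_left, tsum_lubichCoeff hα₁ hα₂ (hz ω), lubichMultiplier]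
    ring
  have hint : Integrable fun ω ↦ ∑' k, T k ω := by
    refine Integrable.mono' (hf.norm.const_mul (∑' k, ‖lubichCoeff α k‖)) ?_ ?_
    · exact aestronglyMeasurable_of_tendsto_ae atTop
        (fun n ↦ (integrable_finsetSum (Finset.range n) fun k _ ↦ hTi k).1)
        (Eventually.of_forall fun ω ↦ (Summable.of_norm (by
          simp only [hTn]; exact hsum.mul_right _)).hasSum.tendsto_sum_nat)
    · refine Eventually.of_forall fun ω ↦ tsum_of_norm_bounded (hsum.hasSum.mul_right ‖f ω‖) ?_
      exact fun k ↦ (hTn k ω).le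
  refine ⟨(hint.const_mul ((1 / h ^ α : ℝ) : ℂ)).congr (Eventually.of_forall hpt), ?_⟩
  simp only [← hpt]
  rw [integral_const_mul, ← integral_tsum_of_summable_integral_norm hTi hsT, lubichOp]
  congr 1
  refine tsum_congr fun k ↦ ?_
  rw [lubichTerm, fourierInv_eq_integral, integral_const_mul]

/-- Scaling: apply the symbol bound at hζ and divide by h^α; the exponent α + 3 leaves h³. -/
lemma norm_freq_cpow_sub_lubichMultiplier_le {α : ℝ} {ι : Type*} {J : Finset ι} {c : ι → ℝ}
    {m : ι → ℤ} {C : ℝ}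
    (hC : ∀ ζ : ℂ, ζ.re = 0 → ‖ζ ^ (α : ℂ) - ∑ j ∈ J, (c j : ℂ) * (Complex.exp (((m j : ℝ) : ℂ) * ζ) *
      lubichSymbol α (Complex.exp (-ζ)))‖ ≤ C * ‖ζ‖ ^ (α + 3))
    {h ω : ℝ} (hh : 0 < h) (hω : ω ≠ 0) :
    ‖freq ω ^ (α : ℂ) - ∑ j ∈ J, (c j : ℂ) * lubichMultiplier α (m j) h ω‖ ≤
      C * h ^ 3 * ‖freq ω‖ ^ (α + 3) := by
  have hζ := hC (freq ω * h) (by simp)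
  have hhα : (0 : ℝ) < h ^ α := by positivity
  have hmul : (freq ω * h) ^ (α : ℂ) = ((h ^ α : ℝ) : ℂ) * freq ω ^ (α : ℂ) := by
    rw [mul_comm, mul_cpow_of_re (by simpa) (by simp) (freq_ne_zero hω), Complex.ofReal_cpow hh.le]
  have hne : ((h ^ α : ℝ) : ℂ) ≠ 0 := by exact_mod_cast hhα.ne'
  have hfac : (freq ω * h) ^ (α : ℂ) - ∑ j ∈ J, (c j : ℂ) * (Complex.exp (((m j : ℝ) : ℂ) *
      (freq ω * h)) * lubichSymbol α (Complex.exp (-(freq ω * h)))) = ((h ^ α : ℝ) : ℂ) *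
      (freq ω ^ (α : ℂ) - ∑ j ∈ J, (c j : ℂ) * lubichMultiplier α (m j) h ω) := by
    rw [hmul, mul_sub, Finset.mul_sum]
    congr 1
    refine Finset.sum_congr rfl fun j _ ↦ ?_
    rw [lubichMultiplier, one_div, Complex.ofReal_inv]
    field_simp
  rw [hfac, norm_mul, norm_mul, Complex.norm_real, Complex.norm_real, Real.norm_of_nonneg hhα.le,
    Real.norm_of_nonneg hh.le, Real.mul_rpow (norm_nonneg _) hh.le, Real.rpow_add hh] at hζ
  refine le_of_mul_le_mul_left (hζ.trans_eq ?_) hhα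
  have h3 : h ^ (3 : ℝ) = h ^ 3 := by norm_cast
  rw [h3]
  ring

lemma lubichOp₃_eq_sum (α : ℝ) (p q r s : ℤ) (h : ℝ) (u : ℝ → ℂ) (x : ℝ) :
    lubichOp₃ α p q r s h u x = ∑ j : Fin 4,
      ((![weight₃ α p q r s * ((q : ℝ) / (q - p)), weight₃ α p q r s * ((p : ℝ) / (p - q)),
        weight₃ α r s p q * ((s : ℝ) / (s - r)), weight₃ α r s p q * ((r : ℝ) / (r - s))] j : ℝ) : ℂ)
        * lubichOp α (![p, q, r, s] j) h u x := by
  simp only [Fin.sum_univ_four, lubichOp₃, lubichOp₂, Matrix.cons_val]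
  push_cast
  ring

/-- `_{3L}A_{p,q,r,s}` matches the symbol `ζ^α` to third order on the imaginary axis. -/
lemma exists_norm_lubichOp₃_symbol_le {α : ℝ} (hα₁ : 1 < α) (hα₂ : α < 2) {p q r s : ℤ}
    (hpq : p ≠ q) (hrs : r ≠ s) (hne : r * s ≠ p * q) :
    ∃ C : ℝ, ∀ ζ : ℂ, ζ.re = 0 → ‖ζ ^ (α : ℂ) - ∑ j : Fin 4,
      ((![weight₃ α p q r s * ((q : ℝ) / (q - p)), weight₃ α p q r s * ((p : ℝ) / (p - q)),
        weight₃ α r s p q * ((s : ℝ) / (s - r)), weight₃ α r s p q * ((r : ℝ) / (r - s))] j : ℝ) : ℂ)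
        * (Complex.exp (((![p, q, r, s] j : ℝ) : ℂ) * ζ) * lubichSymbol α (Complex.exp (-ζ)))‖ ≤
      C * ‖ζ‖ ^ (α + 3) := by
  have h1 : (q : ℝ) - p ≠ 0 := sub_ne_zero.mpr (by exact_mod_cast hpq.symm)
  have h2 : (s : ℝ) - r ≠ 0 := sub_ne_zero.mpr (by exact_mod_cast hrs.symm)
  have h3 : (r : ℝ) * s - p * q ≠ 0 := sub_ne_zero.mpr (by exact_mod_cast hne)
  have h1' : (p : ℝ) / (p - q) = -(p / (q - p)) := by rw [← neg_sub, div_neg]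
  have h2' : (r : ℝ) / (r - s) = -(r / (s - r)) := by rw [← neg_sub, div_neg]
  have h3' : weight₃ α r s p q = -((3 * ((p : ℝ) * q) + 2 * α) / (3 * ((r : ℝ) * s - p * q))) := by
    rw [weight₃, ← neg_sub, mul_neg, div_neg]
  apply exists_norm_sum_lubichSymbol_sub_le hα₁ hα₂ (Finset.univ : Finset (Fin 4))
    (a := fun j ↦ (![p, q, r, s] j : ℝ))
  -- The weights of a pair (p, q) have moments 1, 0, -pq of orders 0, 1, 2. The outer weights solve
  -- w + w' = 1 and w·pq + w'·rs = -2α/3.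
  all_goals
    simp only [Fin.sum_univ_four, Matrix.cons_val]
    rw [h1', h2', h3', weight₃]
    field_simp
    ring

/-! ### The Riemann–Liouville derivative in the frequency domain -/

lemma rlOrder_of_lt {α : ℝ} (hα₁ : 1 < α) (hα₂ : α < 2) : rlOrder α = 2 := by
  have : ⌊α⌋₊ = 1 := (Nat.floor_eq_iff (by linarith)).mpr ⟨by simpa using hα₁.le, by norm_num; linarith⟩
  rw [rlOrder, this]

lemma rlOrder_add_three {α : ℝ} (hα₁ : 1 < α) (hα₂ : α < 2) : rlOrder (α + 3) = 5 := by
  have h := rlOrder_of_lt hα₁ hα₂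
  have h3 : ⌊α + 3⌋₊ = ⌊α⌋₊ + 3 := Nat.floor_add_natCast (by linarith) 3
  rw [rlOrder] at h ⊢
  omega

/-- Interpolation: |ζ|^k ≤ 1 + |ζ|^n for k ≤ n. -/
lemma integrable_freq_pow_mul {f : ℝ → ℂ} {n k : ℕ} (hf : Integrable f)
    (hn : Integrable fun ω ↦ freq ω ^ n * f ω) (hk : k ≤ n) :
    Integrable fun ω ↦ freq ω ^ k * f ω := by
  refine (hf.norm.add hn.norm).mono' ((Measurable.aestronglyMeasurable (by fun_prop)).mul hf.1)
    (Eventually.of_forall fun ω ↦ ?_)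
  simp only [Pi.add_apply, norm_mul, norm_pow]
  rw [← one_add_mul (‖freq ω‖ ^ n)]
  gcongr
  rcases le_total ‖freq ω‖ 1 with h | h
  · linarith [pow_le_one₀ (n := k) (norm_nonneg (freq ω)) h, pow_nonneg (norm_nonneg (freq ω)) n]
  · linarith [pow_le_pow_right₀ h hk]

lemma iteratedDeriv_two_fourierInv {f : ℝ → ℂ} (hf : Integrable f)
    (h1 : Integrable fun ω ↦ freq ω ^ 1 * f ω) (h2 : Integrable fun ω ↦ freq ω ^ 2 * f ω) :
    iteratedDeriv 2 (𝓕⁻ f) = 𝓕⁻ fun ω ↦ freq ω ^ 2 * f ω := by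
  simp only [pow_one] at h1
  simp only [pow_two, mul_assoc] at h2 ⊢
  rw [iteratedDeriv_succ, iteratedDeriv_one, funext fun x ↦ (hasDerivAt_fourierInv hf h1 x).deriv]
  exact funext fun x ↦ (hasDerivAt_fourierInv h1 h2 x).deriv

end WSLD

end

/-! ### The uniform third-order estimate -/

open MeasureTheory Set WSLD Filter Topology
open scoped FourierTransform

theorem theorem2p2 (α : ℝ) (hα₁ : 1 < α) (hα₂ : α < 2)
    (p q r s : ℤ) (hpq : p ≠ q) (hrs : r ≠ s) (hne : r * s ≠ p * q)
    (u : ℝ → ℂ) (hu : Continuous u)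
    (hu_int : MeasureTheory.Integrable u)
    (hu_fourier : MeasureTheory.Integrable (FourierTransform.fourier u : ℝ → ℂ))
    (hD : WSLD.HasLeftRLDeriv (α + 3) u)
    (hD_int : MeasureTheory.Integrable (WSLD.leftRLDeriv (α + 3) u))
    (hD_fourier : MeasureTheory.Integrable
      (FourierTransform.fourier (WSLD.leftRLDeriv (α + 3) u) : ℝ → ℂ)) :
    WSLD.HasLeftRLDeriv α u ∧
    (∀ (m : ℤ) (h : ℝ), 0 < h → ∀ x : ℝ, Summable (WSLD.lubichTerm α m h u x)) ∧
    ∃ C : ℝ, ∀ h : ℝ, 0 < h → ∀ x : ℝ,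
      ‖WSLD.leftRLDeriv α u x - WSLD.lubichOp₃ α p q r s h u x‖ ≤ C * h ^ 3 := by
  set f : ℝ → ℂ := 𝓕 u with hf
  have huf : u = 𝓕⁻ f := (hu.fourierInv_fourier_eq hu_int hu_fourier).symm
  obtain ⟨B, hB⟩ := exists_norm_fourier_le u
  have e2 : rlOrder α = 2 := rlOrder_of_lt hα₁ hα₂
  have e5 : rlOrder (α + 3) = 5 := rlOrder_add_three hα₁ hα₂
  -- Orders α and α + 3 use the same fractional integral, of order 2 - α, with 2 and 5 derivatives.
  -- Existence of the lower derivative is therefore contained in that of the higher.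
  have hγ : ((rlOrder (α + 3) : ℕ) : ℝ) - (α + 3) = 2 - α := by rw [e5]; push_cast; ring
  have hγ' : ((rlOrder α : ℕ) : ℝ) - α = 2 - α := by rw [e2]; norm_num
  unfold HasLeftRLDeriv at hD ⊢
  unfold leftRLDeriv at hD_int hD_fourier ⊢
  rw [hγ, e5] at hD hD_int hD_fourier
  rw [hγ', e2]
  refine ⟨⟨hD.1, fun k hk ↦ hD.2 k (by omega)⟩, fun m h _ x ↦
    summable_lubichTerm hα₁ hα₂ (fun y ↦ by rw [huf]; exact norm_fourierInv_le f y) m h x, ?_⟩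
  -- The fractional integral and its fifth derivative are inverse Fourier transforms.
  set b : ℝ → ℂ := fun ω ↦ freq ω ^ (-((2 - α : ℝ) : ℂ)) * f ω with hb
  have hbi : Integrable b :=
    integrable_freq_cpow_mul hu_fourier hB (by linarith) (by linarith)
  have hF : leftRLIntegral (2 - α) u = 𝓕⁻ b := by
    ext x
    have hx := hD.1 x
    rw [huf] at hx ⊢
    exact leftRLIntegral_fourierInv (by linarith) hu_fourier hbi hx
  rw [hF] at hD hD_int hD_fourier ⊢
  set a : ℝ → ℂ := 𝓕 (iteratedDeriv 5 (𝓕⁻ b)) with ha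
  -- The fifth derivative is not assumed continuous: inversion holds almost everywhere, and being a
  -- derivative upgrades it to every point.
  have h5 : iteratedDeriv 5 (𝓕⁻ b) = 𝓕⁻ a := by
    have hae := ae_eq_fourierInv_fourier hD_int hD_fourier
    rw [← ha, iteratedDeriv_succ] at hae
    rw [iteratedDeriv_succ] at hD_int ⊢
    exact deriv_eq_of_ae_eq (hD.2 4 (by norm_num)) hD_int (continuous_fourierInv hD_fourier) hae
  have hab := ae_eq_freq_pow_mul hD_fourier hbi hD.2 h5
  have hb5 := hD_fourier.congr hab
  have hb2 := integrable_freq_pow_mul hbi hb5 (by norm_num : 2 ≤ 5)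
  rw [iteratedDeriv_two_fourierInv hbi (integrable_freq_pow_mul hbi hb5 (by norm_num)) hb2]
  have hbα : ∀ ω ≠ 0, freq ω ^ 2 * b ω = freq ω ^ (α : ℂ) * f ω := by
    intro ω hω
    rw [hb]
    simp only
    rw [← mul_assoc, ← Complex.cpow_two, ← Complex.cpow_add _ _ (freq_ne_zero hω)]
    congr 2
    push_cast
    ring
  have hba : ∀ ω ≠ 0, ‖freq ω ^ 5 * b ω‖ = ‖freq ω‖ ^ (α + 3) * ‖f ω‖ := by
    intro ω hω
    have hpos : 0 < ‖freq ω‖ := norm_pos_iff.mpr (freq_ne_zero hω)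
    rw [hb, norm_mul, norm_mul, norm_pow, ← Complex.ofReal_neg, Complex.norm_cpow_real, ← mul_assoc,
      ← Real.rpow_natCast, ← Real.rpow_add hpos]
    congr 2
    push_cast
    ring
  obtain ⟨C, hC⟩ := exists_norm_lubichOp₃_symbol_le hα₁ hα₂ hpq hrs hne
  -- Almost everywhere |a| = |ζ|^{α+3}|f|, exactly the weight in the symbol error.
  refine ⟨C * ∫ ω, ‖a ω‖, fun h hh x ↦ ?_⟩
  have hL (m : ℤ) := integrable_and_lubichOp_fourierInv hα₁ hα₂ hu_fourier m h x
  rw [lubichOp₃_eq_sum, huf, fourierInv_eq_integral]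
  simp only [(hL _).2, ← integral_const_mul]
  rw [← integral_finsetSum _ fun j _ ↦ (hL _).1.const_mul _,
    ← integral_sub (integrable_cexp_mul hb2 x)
      (integrable_finsetSum _ fun j _ ↦ (hL _).1.const_mul _),
    ← integral_mul_const]
  refine norm_integral_le_of_norm_le ((hD_fourier.norm.const_mul _).mul_const _) ?_
  filter_upwards [hab, Measure.ae_ne volume (0 : ℝ)] with ω haω hω
  have hbound := norm_freq_cpow_sub_lubichMultiplier_le hC hh hω
  rw [haω, hba ω hω, hbα ω hω]
  refine le_trans (le_of_eq ?_) ((mul_le_mul_of_nonneg_right hbound (norm_nonneg (f ω))).trans_eq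
    (by ring))
  rw [← norm_mul, ← one_mul ‖_ * f ω‖, ← norm_cexp_freq_mul ω x, ← norm_mul, sub_mul, mul_sub,
    Finset.sum_mul, Finset.mul_sum]
  congr 2
  exact Finset.sum_congr rfl fun j _ ↦ by ring
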